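/- Let $N\in\mathbb N$ with $N>1$, $\bar\tau>0$, $\omega>0$ and $\varepsilon\in(-1,0)$, and let $P_N:=[0,\bar\tau]^N\subset\mathbb R^N$, with the Euclidean norm. Consider the hybrid system $\mathcal H_N=(C,f,D,G)$ of $N$ impulse-coupled oscillators: $C:=P_N$; $f(\tau):=\omega\mathbf 1$, where $\mathbf 1=(1,\dots,1)$; $D:=\{\tau\in P_N:\ \tau_i=\bar\tau\text{ for some }i\}$; and, for $\tau\in D$, $G(\tau):=g_1(\tau)\times\dots\times g_N(\tau)$, where $$g_i(\tau)=\begin{cases}\{0\}&\text{if }\tau_i=\bar\tau\text{ and }\tau_r<\bar\tau\text{ for all }r\ne i,\\ \{0,(1+\varepsilon)\tau_i\}&\text{if }\tau_i=\bar\tau\text{ and }\tau_r=\bar\tau\text{ for some }r\neq i,\\ \{(1+\varepsilon)\tau_i\}&\text{if }\tau_i<\bar\tau\text{ and }\tau_r=\bar\tau\text{ for some }r\ne i.\end{cases}$$ Solutions are hybrid arcs on hybrid time domains, in the following sense. A compact hybrid time domain is a set $\bigcup_{j=0}^{J-1}[t_j,t_{j+1}]\times\{j\}$ with $0=t_0\le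 t_1\le\dots\le t_J$; a hybrid time domain is a set $S\subset\mathbb R_{\ge0}\times\mathbb N$ such that $S\cap([0,T]\times\{0,\dots,J\})$ is a compact hybrid time domain for every $(T,J)\in S$. A solution is a function $x:\operatorname{dom}x\to\mathbb R^N$ on a hybrid time domain containing $(0,0)$ such that $x(0,0)\in C\cup D$; $t\mapsto x(t,j)$ is locally absolutely continuous for each $j$; $x(t,j)\in C$ and $\dot x(t,j)=f(x(t,j))$ for each $j$ and almost every $t$ with $(t,j)\in\operatorname{dom}x$; and $x(t,j)\in D$, $x(t,j+1)\in G(x(t,j))$ whenever $(t,j),(t,j+1)\in\operatorname{dom}x$. It is maximal if it is not the restriction of another solution to a proper subset of the latter's domain, and complete if its domain is unbounded. For a nonempty closed set $\mathcal A$ write $|x|_{\mathcal A}$ for the distance from $x$ to $\mathcal A$, and say that $x$ converges to $\mathcal A$ if $|x(t,j)|_{\mathcal A}\to0$ as $t+j\to\infty$ with $(t,j)\in\operatorname{dom}x$. The set $\mathcal A$ is - stable if for each $r>0$ there is $\delta>0$ such that each solution $x$ with $|x(0,0)|_{\mathcal A}\le\delta$ satisfies $|x(t,j)|_{\mathcal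 A}\le r$ for all $(t,j)\in\operatorname{dom}x$; - attractive if there is $\mu>0$ such that every maximal solution $x$ with $|x(0,0)|_{\mathcal A}\le\mu$ is complete and converges to $\mathcal A$; - asymptotically stable if it is stable and attractive; - weakly globally asymptotically stable if it is stable and from every point of $C\cup D$ there is a maximal solution that is complete and converges to $\mathcal A$. The basin of attraction of $\mathcal A$ is the set of points of $C\cup D$ from which every maximal solution is complete and converges to $\mathcal A$. For $k\in\{1,\dots,N\}$ put $$\tau_s^k:=\frac{\sum_{p=0}^{N-k}(\varepsilon+1)^p}{\sum_{p=0}^{N-1}(\varepsilon+1)^p}\,\bar\tau ,$$ and let the desynchronization set $\mathcal A$ be the union, over the $N!$ permutations $\sigma$ of $\{1,\dots,N\}$, of the sets $$\ell_\sigma:=\{\tau\in P_N:\ \tau=(\tau_s^{\sigma(1)},\dots,\tau_s^{\sigma(N)})+s\mathbf 1\text{ for some }s\in\mathbb R\}.$$ Let $\mathcal S:=\{\tau\in P_N:\ \tau_i=\tau_r\text{ for some }i\neq r\}$, $\mathcal G:=\{\tau\in D\setminus\mathcal S:\ \tau_i=0\text{ and }\tau_r=\bar\tau\text{ for some }i\ne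 r\}$ (the states with distinct timers for which two timers coincide after one jump), and $\mathcal X:=\mathcal S\cup\mathcal G$. Then the set $\mathcal A$ is compact, and for $\mathcal H_N$: 1. $\mathcal A$ is asymptotically stable, with basin of attraction exactly $P_N\setminus\mathcal X$; 2. $\mathcal A$ is weakly globally asymptotically stable. -/

import Mathlib

open Set Filter Topology MeasureTheory

noncomputable section

/-! ### Hybrid systems and their solutions -/

/-- The data `(C, f, D, G)` of a hybrid system with state space `E`: flow set, (single-valued) flow
map, jump set, and (set-valued) jump map. -/
structure HybridSystem (E : Type*) where
  flowSet : Set E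
  flowMap : E → E
  jumpSet : Set E
  jumpMap : E → Set E

/-- A compact hybrid time domain: `⋃_{j < J} [t_j, t_{j+1}] × {j}` for some finite sequence
`0 = t_0 ≤ t_1 ≤ ⋯ ≤ t_J`. -/
def IsCompactHybridTimeDomain (S : Set (ℝ × ℕ)) : Prop :=
  ∃ (J : ℕ) (t : ℕ → ℝ), t 0 = 0 ∧ (∀ j < J, t j ≤ t (j + 1)) ∧
    S = {p | p.2 < J ∧ t p.2 ≤ p.1 ∧ p.1 ≤ t (p.2 + 1)}

/-- A hybrid time domain: a subset of `ℝ≥0 × ℕ` all of whose truncations at its own points are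
compact hybrid time domains. -/
def IsHybridTimeDomain (S : Set (ℝ × ℕ)) : Prop :=
  (∀ p ∈ S, 0 ≤ p.1) ∧
    ∀ p ∈ S, IsCompactHybridTimeDomain (S ∩ {q | 0 ≤ q.1 ∧ q.1 ≤ p.1 ∧ q.2 ≤ p.2})

/-- A function on a subset `dom` of hybrid time. The values of `toFun` outside of `dom` are
irrelevant: no notion below refers to them. -/
structure HybridFun (E : Type*) where
  dom : Set (ℝ × ℕ)
  toFun : ℝ → ℕ → E

namespace HybridFun

variable {E : Type*}

/-- The set of times `t` with `(t, j) ∈ dom x`. -/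
def slice (x : HybridFun E) (j : ℕ) : Set ℝ := {t | (t, j) ∈ x.dom}

/-- A hybrid arc: the domain is a hybrid time domain and every `t ↦ x (t, j)` is locally absolutely
continuous, that is, absolutely continuous on each compact interval in its domain. -/
def IsHybridArc [PseudoMetricSpace E] (x : HybridFun E) : Prop :=
  IsHybridTimeDomain x.dom ∧
    ∀ (j : ℕ) (a b : ℝ), a ≤ b → Icc a b ⊆ x.slice j →
      AbsolutelyContinuousOnInterval (fun t => x.toFun t j) a b

/-- A solution to the hybrid system `H`. -/
def IsSolution [NormedAddCommGroup E] [NormedSpace ℝ E] (x : HybridFun E) (H : HybridSystem E) :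
    Prop :=
  x.IsHybridArc ∧
  (0, 0) ∈ x.dom ∧
  x.toFun 0 0 ∈ H.flowSet ∪ H.jumpSet ∧
  (∀ j : ℕ, ∀ᵐ t ∂(volume : Measure ℝ), (t, j) ∈ x.dom →
    x.toFun t j ∈ H.flowSet ∧
      HasDerivWithinAt (fun s => x.toFun s j) (H.flowMap (x.toFun t j)) (x.slice j) t) ∧
  (∀ (t : ℝ) (j : ℕ), (t, j) ∈ x.dom → (t, j + 1) ∈ x.dom →
    x.toFun t j ∈ H.jumpSet ∧ x.toFun t (j + 1) ∈ H.jumpMap (x.toFun t j))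

/-- A solution is maximal if it is not the truncation of another solution to a proper subset of the
domain of the latter. -/
def IsMaximalSolution [NormedAddCommGroup E] [NormedSpace ℝ E] (x : HybridFun E)
    (H : HybridSystem E) : Prop :=
  x.IsSolution H ∧
    ¬ ∃ y : HybridFun E, y.IsSolution H ∧ x.dom ⊂ y.dom ∧
      ∀ (t : ℝ) (j : ℕ), (t, j) ∈ x.dom → x.toFun t j = y.toFun t j

/-- A solution is complete if its domain is unbounded. -/
def IsComplete (x : HybridFun E) : Prop := ¬ Bornology.IsBounded x.dom

/-- `|x (t, j)|_A → 0` as `t + j → ∞` with `(t, j) ∈ dom x`. -/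
def ConvergesTo [PseudoMetricSpace E] (x : HybridFun E) (A : Set E) : Prop :=
  Tendsto (fun p : ℝ × ℕ => Metric.infDist (x.toFun p.1 p.2) A)
    (comap (fun p : ℝ × ℕ => p.1 + (p.2 : ℝ)) atTop ⊓ 𝓟 x.dom) (𝓝 0)

end HybridFun

/-! ### Stability notions (for a nonempty closed set `A`) -/

namespace HybridSystem

variable {E : Type*} [NormedAddCommGroup E] [NormedSpace ℝ E]

def IsStable (H : HybridSystem E) (A : Set E) : Prop :=
  ∀ r > 0, ∃ δ > 0, ∀ x : HybridFun E, x.IsSolution H → Metric.infDist (x.toFun 0 0) A ≤ δ →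
    ∀ (t : ℝ) (j : ℕ), (t, j) ∈ x.dom → Metric.infDist (x.toFun t j) A ≤ r

def IsAttractive (H : HybridSystem E) (A : Set E) : Prop :=
  ∃ μ > 0, ∀ x : HybridFun E, x.IsMaximalSolution H → Metric.infDist (x.toFun 0 0) A ≤ μ →
    x.IsComplete ∧ x.ConvergesTo A

def IsAsymptoticallyStable (H : HybridSystem E) (A : Set E) : Prop :=
  H.IsStable A ∧ H.IsAttractive A

/-- Stability, together with the existence, from every initial condition in `C ∪ D`, of a maximal
solution that is complete and converges to `A`. -/
def IsWeaklyGloballyAsymptoticallyStable (H : HybridSystem E) (A : Set E) : Prop :=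
  H.IsStable A ∧
    ∀ ξ ∈ H.flowSet ∪ H.jumpSet, ∃ x : HybridFun E, x.IsMaximalSolution H ∧ x.toFun 0 0 = ξ ∧
      x.IsComplete ∧ x.ConvergesTo A

/-- The basin of attraction: the initial conditions in `C ∪ D` from which every maximal solution is
complete and converges to `A`. -/
def basinOfAttraction (H : HybridSystem E) (A : Set E) : Set E :=
  {ξ | ξ ∈ H.flowSet ∪ H.jumpSet ∧
    ∀ x : HybridFun E, x.IsMaximalSolution H → x.toFun 0 0 = ξ → x.IsComplete ∧ x.ConvergesTo A}

end HybridSystem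

/-! ### Impulse-coupled oscillators -/

namespace ImpulseOscillators

/-- The cube `P_N = [0, τbar]^N`. -/
def cube (N : ℕ) (τbar : ℝ) : Set (EuclideanSpace ℝ (Fin N)) :=
  {τ | ∀ i, 0 ≤ τ i ∧ τ i ≤ τbar}

/-- The jump set `D`: some timer is at the threshold. -/
def jumpSet (N : ℕ) (τbar : ℝ) : Set (EuclideanSpace ℝ (Fin N)) :=
  {τ | τ ∈ cube N τbar ∧ ∃ i, τ i = τbar}

/-- The `i`-th component `g_i` of the jump map, as the set of admissible values. -/
def jumpComponent {N : ℕ} (τbar ε : ℝ) (i : Fin N) (τ : EuclideanSpace ℝ (Fin N)) : Set ℝ :=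
  {v | (τ i = τbar ∧ (∀ r, r ≠ i → τ r < τbar) ∧ v = 0) ∨
       (τ i = τbar ∧ (∃ r, r ≠ i ∧ τ r = τbar) ∧ (v = 0 ∨ v = (1 + ε) * τ i)) ∨
       (τ i < τbar ∧ (∃ r, r ≠ i ∧ τ r = τbar) ∧ v = (1 + ε) * τ i)}

/-- The hybrid system `H_N` of `N` impulse-coupled oscillators. -/
def system (N : ℕ) (τbar ω ε : ℝ) : HybridSystem (EuclideanSpace ℝ (Fin N)) where
  flowSet := cube N τbar
  flowMap := fun _ => WithLp.toLp 2 (fun _ => ω)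
  jumpSet := jumpSet N τbar
  jumpMap := fun τ => {y | ∀ i, y i ∈ jumpComponent τbar ε i τ}

/-- The states in which two timers coincide. -/
def coincident (N : ℕ) (τbar : ℝ) : Set (EuclideanSpace ℝ (Fin N)) :=
  {τ | τ ∈ cube N τbar ∧ ∃ i r, i ≠ r ∧ τ i = τ r}

/-- The jump states with distinct timers for which two timers coincide after the jump: one timer is
at zero and another one is at the threshold. -/
def coincidentAfterJump (N : ℕ) (τbar : ℝ) : Set (EuclideanSpace ℝ (Fin N)) :=
  {τ | τ ∈ jumpSet N τbar \ coincident N τbar ∧ ∃ i r, i ≠ r ∧ τ i = 0 ∧ τ r = τbar}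

/-- The exceptional set `X`. -/
def exceptionalSet (N : ℕ) (τbar : ℝ) : Set (EuclideanSpace ℝ (Fin N)) :=
  coincident N τbar ∪ coincidentAfterJump N τbar

/-- The sorted desynchronized jump point `τ_s`. With `k ∈ {1, …, N}` as index its entries are
`(∑_{p=0}^{N-k} (ε+1)^p) / (∑_{p=0}^{N-1} (ε+1)^p) * τbar`; below, `k` starts at `0`. -/
def sortedPoint (N : ℕ) (τbar ε : ℝ) (k : Fin N) : ℝ :=
  (∑ p ∈ Finset.range (N - (k : ℕ)), (ε + 1) ^ p) / (∑ p ∈ Finset.range N, (ε + 1) ^ p) * τbar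

/-- The line `ℓ_σ`: the points of the cube of the form `τ̃ + s 𝟏`, where `τ̃` is the rearrangement of
`τ_s` by the permutation `σ`. -/
def desyncLine (N : ℕ) (τbar ε : ℝ) (σ : Equiv.Perm (Fin N)) : Set (EuclideanSpace ℝ (Fin N)) :=
  {τ | τ ∈ cube N τbar ∧ ∃ s : ℝ, ∀ i, τ i = sortedPoint N τbar ε (σ i) + s}

/-- The desynchronization set: the union of the `N!` lines. -/
def desyncSet (N : ℕ) (τbar ε : ℝ) : Set (EuclideanSpace ℝ (Fin N)) :=
  ⋃ σ : Equiv.Perm (Fin N), desyncLine N τbar ε σ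

/-- The matrix `Γ` of the linear system `Γ τ_s = τbar 𝟏` that characterizes the sorted
desynchronized jump point: the first row is that of the identity, and row `i` of the others reads
`τ_i + (1+ε) τ_2 - (1+ε) τ_{i+1}` with `τ_{N+1} = 0` (indices from `1`). -/
def desyncMatrix (N : ℕ) (ε : ℝ) : Matrix (Fin N) (Fin N) ℝ :=
  Matrix.of fun i j =>
    (if j = i then 1 else 0) +
      (if 1 ≤ (i : ℕ) then
        (if (j : ℕ) = 1 then 1 + ε else 0) - (if (j : ℕ) = (i : ℕ) + 1 then 1 + ε else 0)
      else 0)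

theorem sum_ite_val (N : ℕ) (c : ℝ) (v : Fin N → ℝ) (k : ℕ) :
    ∑ j : Fin N, (if (j : ℕ) = k then c else 0) * v j =
      c * (if h : k < N then v ⟨k, h⟩ else 0) := by
  by_cases h : k < N
  · rw [Finset.sum_eq_single (⟨k, h⟩ : Fin N)]
    · simp [h]
    · intro b _ hb
      have : (b : ℕ) ≠ k := fun e => hb (Fin.ext e)
      simp [this]
    · simp
  · rw [Finset.sum_eq_zero]
    · simp [h]
    · intro b _
      have : (b : ℕ) ≠ k := by have := b.2; omega
      simp [this]

theorem desyncMatrix_mulVec (N : ℕ) (ε : ℝ) (v : Fin N → ℝ) (i : Fin N) :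
    (desyncMatrix N ε).mulVec v i = v i + (if 1 ≤ (i : ℕ) then
      (1 + ε) * (if h : 1 < N then v ⟨1, h⟩ else 0) -
        (1 + ε) * (if h : (i : ℕ) + 1 < N then v ⟨i + 1, h⟩ else 0) else 0) := by
  simp only [Matrix.mulVec, dotProduct, desyncMatrix, Matrix.of_apply]
  by_cases hi : 1 ≤ (i : ℕ)
  · simp only [hi, if_true, add_mul, sub_mul, Finset.sum_add_distrib, Finset.sum_sub_distrib,
      sum_ite_val]
    simp
  · simp [hi]

/-- The closed form is the one and only solution of the linear system. -/
theorem desyncMatrix_mulVec_eq_iff (N : ℕ) (hN : 1 < N) (τbar ε : ℝ) (hε : -1 < ε)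
    (v : Fin N → ℝ) :
    (desyncMatrix N ε).mulVec v = (fun _ => τbar) ↔ v = sortedPoint N τbar ε := by
  set T : ℕ → ℝ := fun m => ∑ p ∈ Finset.range m, (ε + 1) ^ p with hT
  have hTs : ∀ m, T (m + 1) = (ε + 1) * T m + 1 := by
    intro m
    simp only [hT, Finset.sum_range_succ', Finset.mul_sum, pow_succ']
    simp
  have hTpos : 0 < T N := by
    apply Finset.sum_pos
    · intro p _
      have : 0 < ε + 1 := by linarith
      positivity
    · exact ⟨0, by simp; omega⟩
  have hsp : ∀ k : Fin N, sortedPoint N τbar ε k = T (N - k) / T N * τbar := fun k => rfl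
  constructor
  · intro h
    have hrow : ∀ i : Fin N, _ := fun i => (desyncMatrix_mulVec N ε v i).symm.trans (congrFun h i)
    have key : ∀ m (hm : m + 1 < N), v ⟨N - (m + 1), by omega⟩
        = (τbar - (1 + ε) * v ⟨1, hN⟩) * T (m + 1) := by
      intro m
      induction m with
      | zero =>
        intro hm
        have := hrow ⟨N - (0 + 1), by omega⟩
        have h1 : 1 ≤ N - (0 + 1) := by omega
        have h2 : ¬ (N - (0 + 1) + 1 < N) := by omega
        simp only [h1, h2, hN, if_true, dif_pos, dif_neg, not_false_iff] at this
        have h0 : T (0 + 1) = 1 := by simp [hT]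
        rw [h0]; linarith
      | succ m ih =>
        intro hm
        have ih' := ih (by omega)
        have := hrow ⟨N - (m + 1 + 1), by omega⟩
        have h1 : 1 ≤ N - (m + 1 + 1) := by omega
        have h2 : N - (m + 1 + 1) + 1 < N := by omega
        simp only [h1, h2, hN, if_true, dif_pos] at this
        have e : (⟨N - (m + 1 + 1) + 1, h2⟩ : Fin N) = ⟨N - (m + 1), by omega⟩ :=
          Fin.ext (by simp only; omega)
        rw [e, ih'] at this
        rw [hTs (m + 1)]; linarith
    have k1 := key (N - 2) (by omega)
    have e1 : (⟨N - (N - 2 + 1), by omega⟩ : Fin N) = ⟨1, hN⟩ := Fin.ext (by simp only; omega)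
    rw [e1] at k1
    have hTN : T N = (ε + 1) * T (N - 2 + 1) + 1 := by
      rw [← hTs]; congr 1; omega
    have hc : τbar - (1 + ε) * v ⟨1, hN⟩ = τbar / T N := by
      rw [eq_div_iff hTpos.ne', hTN]
      linear_combination -(1 + ε) * k1
    funext k
    rw [hsp]
    by_cases hk : (k : ℕ) = 0
    · have := hrow k
      simp only [hk] at this
      simp at this
      rw [this, hk, Nat.sub_zero, div_self hTpos.ne', one_mul]
    · have := key (N - k - 1) (by omega)
      have e : (⟨N - (N - k - 1 + 1), by omega⟩ : Fin N) = k :=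
        Fin.ext (by have := k.2; simp only; omega)
      rw [e, hc] at this
      have e2 : N - (k : ℕ) - 1 + 1 = N - k := by have := k.2; omega
      rw [this, e2]; ring
  · rintro rfl
    funext i
    rw [desyncMatrix_mulVec]
    have hi := i.2
    by_cases h0 : (i : ℕ) = 0
    · simp [h0, hsp, div_self hTpos.ne']
    · have h1 : 1 ≤ (i : ℕ) := by omega
      have a1 : T N = (ε + 1) * T (N - 1) + 1 := by rw [← hTs]; congr 1; omega
      have a2 : T (N - i) = (ε + 1) * T (N - (i + 1)) + 1 := by rw [← hTs]; congr 1; omega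
      have a3 : (if h : (i : ℕ) + 1 < N then sortedPoint N τbar ε ⟨i + 1, h⟩ else 0)
          = T (N - (i + 1)) / T N * τbar := by
        by_cases h : (i : ℕ) + 1 < N
        · simp only [h, dif_pos, hsp]
        · have : N - ((i : ℕ) + 1) = 0 := by omega
          simp [h, this, hT]
      simp only [h1, if_true, hN, dif_pos, a3]
      simp only [hsp]
      have : T (N - i) + (1 + ε) * T (N - 1) - (1 + ε) * T (N - (i + 1)) = T N := by
        rw [a1, a2]; ring
      have h3 := hTpos.ne'
      field_simp
      linear_combination τbar * this

end ImpulseOscillators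

end

/-!
Let `q = 1 + ε`, let `c` be the smallest entry of the sorted desynchronized point `τ_s`, and let `σ`
rank the timers of a state `τ` in descending order. The entries of `τ_s` satisfy
`τ_s^k = q τ_s^{k+1} + c`, and `τ_s^1 = τbar`, `τ_s^N = c`. Consider the deviations
`w i = τ i - τ_s^{σ i}`. The flow adds the same number to all of them. At a jump that resets just
the top timer, that timer gets the lowest rank and all others move up by one; the recursion for
`τ_s` turns this into `w i ↦ q * w i - c` for *every* `i` (`deviation_resetTop`). Hence the spread
`max w - min w` is constant along flows and shrinks by the factor `q < 1` at such jumps. The spread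
is comparable to the distance to the line `ℓ_σ` (`infDist_desyncSet_le`,
`exists_spreadLE_of_infDist_le`), and the time between jumps is bounded, so that solutions all of
whose jumps reset only the top timer converge to the desynchronization set
(`FollowsRanking.convergesTo`).

* From a state outside of the exceptional set, no ties ever arise, so all jumps are forced to be of
  this kind (`IsJumpSeq.followsRanking`). States near the desynchronization set are of this type,
  because the entries of `τ_s` are separated from each other and from `0`. This gives stability,
  attractivity and one inclusion for the basin of attraction.
* From any state, ties included, the jump that resets just one top timer is admissible. Choosing it
  every time gives weak global asymptotic stability (`exists_followsRanking`).
* From an exceptional state, the choice to reset all timers at the threshold keeps two timers equal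
  after the first jump, which keeps the state away from the desynchronization set
  (`exists_isJumpSeq_tie`, `not_convergesTo_of_tie`).

The passage from solutions to sequences of jumps rests on `exists_isJumpSeq_of_isSolution`: every
solution is a restriction of one determined by the sequence of its states right after the jumps.
The definition of hybrid time domains by itself allows `t ↦ (t, j)` to go on after a jump from the
`j`-th interval; here this is excluded because the flow leaves the cube at the jump set.
-/

noncomputable section

/-! ### Hybrid time domains -/

theorem IsHybridTimeDomain.Icc_subset {S : Set (ℝ × ℕ)} (hS : IsHybridTimeDomain S) {a b : ℝ}
    {j : ℕ} (ha : (a, j) ∈ S) (hb : (b, j) ∈ S) {s : ℝ} (hs : s ∈ Icc a b) : (s, j) ∈ S := by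
  obtain ⟨J, t, -, -, h⟩ := hS.2 _ hb
  have ha0 : 0 ≤ a := hS.1 _ ha
  have h1 : (a, j) ∈ S ∩ {q | 0 ≤ q.1 ∧ q.1 ≤ b ∧ q.2 ≤ j} := ⟨ha, ha0, hs.1.trans hs.2, le_rfl⟩
  have h2 : (b, j) ∈ S ∩ {q | 0 ≤ q.1 ∧ q.1 ≤ b ∧ q.2 ≤ j} :=
    ⟨hb, ha0.trans (hs.1.trans hs.2), le_rfl, le_rfl⟩
  rw [h] at h1 h2
  have h3 : (s, j) ∈ {p : ℝ × ℕ | p.2 < J ∧ t p.2 ≤ p.1 ∧ p.1 ≤ t (p.2 + 1)} :=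
    ⟨h1.1, h1.2.1.trans hs.1, hs.2.trans h2.2.2⟩
  rw [← h] at h3
  exact h3.1

/-- A point of a hybrid time domain that lies after a jump is preceded by that jump. -/
theorem IsHybridTimeDomain.exists_jump_le {S : Set (ℝ × ℕ)} (hS : IsHybridTimeDomain S) {a : ℝ}
    {j : ℕ} (ha : (a, j + 1) ∈ S) : ∃ s ≤ a, (s, j) ∈ S ∧ (s, j + 1) ∈ S := by
  obtain ⟨J, t, -, hmono, h⟩ := hS.2 _ ha
  have h1 : (a, j + 1) ∈ S ∩ {q | 0 ≤ q.1 ∧ q.1 ≤ a ∧ q.2 ≤ j + 1} :=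
    ⟨ha, hS.1 _ ha, le_rfl, le_rfl⟩
  rw [h] at h1
  obtain ⟨hJ, h1, -⟩ := h1
  have hJ : j + 1 < J := hJ
  have h2 : (t (j + 1), j) ∈ {p : ℝ × ℕ | p.2 < J ∧ t p.2 ≤ p.1 ∧ p.1 ≤ t (p.2 + 1)} :=
    ⟨by change j < J; omega, hmono j (by omega), le_rfl⟩
  have h3 : (t (j + 1), j + 1) ∈ {p : ℝ × ℕ | p.2 < J ∧ t p.2 ≤ p.1 ∧ p.1 ≤ t (p.2 + 1)} :=
    ⟨hJ, le_rfl, hmono (j + 1) hJ⟩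
  rw [← h] at h2 h3
  exact ⟨_, h1, h2.1, h3.1⟩

/-- A nondecreasing sequence of jump times that starts at `0` gives a hybrid time domain. -/
theorem isHybridTimeDomain_of_monotone {t : ℕ → ℝ} (h0 : t 0 = 0) (ht : Monotone t) :
    IsHybridTimeDomain {p : ℝ × ℕ | t p.2 ≤ p.1 ∧ p.1 ≤ t (p.2 + 1)} := by
  refine ⟨fun p hp => (h0 ▸ ht (Nat.zero_le _) : (0 : ℝ) ≤ t p.2).trans hp.1, ?_⟩
  rintro ⟨T, J⟩ ⟨hT1, hT2⟩
  refine ⟨J + 1, fun j => min (t j) T, ?_, fun j _ => min_le_min_right _ (ht j.le_succ), ?_⟩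
  · have : (0 : ℝ) ≤ T := ((h0 ▸ ht (Nat.zero_le _) : (0 : ℝ) ≤ t J)).trans hT1
    simpa [h0] using this
  · ext ⟨s, j⟩
    simp only [mem_inter_iff, mem_ofPred_eq]
    simp only at hT1 hT2
    constructor
    · rintro ⟨⟨h1, h2⟩, h3, h4, h5⟩
      exact ⟨by omega, (min_le_left _ _).trans h1, le_min h2 h4⟩
    · rintro ⟨h1, h2, h3⟩
      have h4 : t j ≤ T := (ht (by omega)).trans hT1
      rw [min_eq_left h4] at h2
      rw [le_min_iff] at h3
      exact ⟨⟨h2, h3.1⟩, (h0 ▸ ht (Nat.zero_le _) : (0 : ℝ) ≤ t j).trans h2, h3.2, by omega⟩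

theorem exists_mem_Ioo_of_ae {p : ℝ → Prop} (h : ∀ᵐ u ∂(volume : Measure ℝ), p u) {a b : ℝ}
    (hab : a < b) : ∃ u ∈ Ioo a b, p u := by
  by_contra! hc
  have h1 : volume (Ioo a b) ≤ 0 := by
    rw [← ae_iff.1 h]
    exact measure_mono fun u hu => hc u hu
  rw [Real.volume_Ioo] at h1
  have := ENNReal.ofReal_pos.2 (sub_pos.2 hab)
  exact absurd h1 (not_le.2 this)

namespace ImpulseOscillators

variable {N : ℕ} {τbar ω ε : ℝ}

/-! ### Flow until the next jump -/

/-- The state reached from `τ` by flowing for the time `s`. -/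
def flow (ω : ℝ) (τ : EuclideanSpace ℝ (Fin N)) (s : ℝ) : EuclideanSpace ℝ (Fin N) :=
  τ + s • WithLp.toLp 2 (fun _ => ω)

@[simp] theorem flow_apply (τ : EuclideanSpace ℝ (Fin N)) (s : ℝ) (i : Fin N) :
    flow ω τ s i = τ i + s * ω := by
  simp [flow]

/-- The time that the largest timer of `τ` needs to reach the threshold. -/
def hitTime (τbar ω : ℝ) (τ : EuclideanSpace ℝ (Fin N)) : ℝ := (τbar - ⨆ i, τ i) / ω

/-- The state at which the flow from `τ` meets the jump set. -/
def hit (τbar ω : ℝ) (τ : EuclideanSpace ℝ (Fin N)) : EuclideanSpace ℝ (Fin N) :=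
  flow ω τ (hitTime τbar ω τ)

theorem le_hitTime_iff (hN : 0 < N) (hω : 0 < ω) (τ : EuclideanSpace ℝ (Fin N)) (s : ℝ) :
    s ≤ hitTime τbar ω τ ↔ ∀ i, flow ω τ s i ≤ τbar := by
  have : Nonempty (Fin N) := ⟨⟨0, hN⟩⟩
  rw [hitTime, le_div_iff₀ hω, le_sub_comm, ciSup_le_iff (Set.finite_range _).bddAbove]
  simp only [flow_apply]
  exact forall_congr' fun i => by constructor <;> intro h <;> linarith

theorem exists_hit_eq (hN : 0 < N) (hω : 0 < ω) (τ : EuclideanSpace ℝ (Fin N)) :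
    ∃ i, hit τbar ω τ i = τbar := by
  have : Nonempty (Fin N) := ⟨⟨0, hN⟩⟩
  obtain ⟨i, hi⟩ := exists_eq_ciSup_of_finite (f := fun i => τ i)
  refine ⟨i, ?_⟩
  rw [hit, flow_apply, hitTime, div_mul_cancel₀ _ hω.ne', ← hi]
  ring

theorem hitTime_nonneg (hN : 0 < N) (hω : 0 < ω) {τ : EuclideanSpace ℝ (Fin N)}
    (hτ : τ ∈ cube N τbar) : 0 ≤ hitTime τbar ω τ :=
  (le_hitTime_iff hN hω τ 0).2 fun i => by simpa using (hτ i).2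

theorem hitTime_le (hN : 0 < N) (hω : 0 < ω) {τ : EuclideanSpace ℝ (Fin N)}
    (hτ : τ ∈ cube N τbar) : hitTime τbar ω τ ≤ τbar / ω := by
  have := (le_hitTime_iff hN hω τ (hitTime τbar ω τ)).1 le_rfl ⟨0, hN⟩
  rw [flow_apply] at this
  rw [le_div_iff₀ hω]
  linarith [(hτ ⟨0, hN⟩).1]

theorem flow_mem_cube (hN : 0 < N) (hω : 0 < ω) {τ : EuclideanSpace ℝ (Fin N)}
    (hτ : τ ∈ cube N τbar) {s : ℝ} (hs : 0 ≤ s) (hs' : s ≤ hitTime τbar ω τ) :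
    flow ω τ s ∈ cube N τbar := fun i =>
  ⟨by rw [flow_apply]; have := (hτ i).1; positivity, (le_hitTime_iff hN hω τ s).1 hs' i⟩

theorem hit_mem_jumpSet (hN : 0 < N) (hω : 0 < ω) {τ : EuclideanSpace ℝ (Fin N)}
    (hτ : τ ∈ cube N τbar) : hit τbar ω τ ∈ jumpSet N τbar :=
  ⟨flow_mem_cube hN hω hτ (hitTime_nonneg hN hω hτ) le_rfl, exists_hit_eq hN hω τ⟩

theorem hitTime_le_of_flow_eq (hN : 0 < N) (hω : 0 < ω) {τ : EuclideanSpace ℝ (Fin N)} {s : ℝ}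
    {i : Fin N} (h : flow ω τ s i = τbar) : hitTime τbar ω τ ≤ s := by
  have := (le_hitTime_iff hN hω τ (hitTime τbar ω τ)).1 le_rfl i
  rw [flow_apply] at this h
  exact le_of_mul_le_mul_right (by linarith) hω

theorem jumpMap_subset_cube (hε : -1 < ε) (hε' : ε < 0) {τ y : EuclideanSpace ℝ (Fin N)}
    (hτ : τ ∈ jumpSet N τbar) (hy : y ∈ (system N τbar ω ε).jumpMap τ) : y ∈ cube N τbar := by
  intro i
  have h0 := (hτ.1 i).1
  have h1 := (hτ.1 i).2
  have h2 : 0 ≤ (1 + ε) * τ i := mul_nonneg (by linarith) h0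
  have h3 : (1 + ε) * τ i ≤ τbar := by nlinarith
  rcases hy i with ⟨-, -, h⟩ | ⟨-, -, h | h⟩ | ⟨-, -, h⟩ <;> rw [h]
  exacts [⟨le_rfl, h0.trans h1⟩, ⟨le_rfl, h0.trans h1⟩, ⟨h2, h3⟩, ⟨h2, h3⟩]

/-! ### Solutions generated by a sequence of jumps -/

/-- `ξ` lists the states right after the jumps of a solution that never stops jumping: the state
`ξ (j + 1)` is a jump successor of the state at which the flow from `ξ j` meets the jump set. -/
def IsJumpSeq (τbar ω ε : ℝ) (ξ : ℕ → EuclideanSpace ℝ (Fin N)) : Prop :=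
  ξ 0 ∈ cube N τbar ∧ ∀ j, ξ (j + 1) ∈ (system N τbar ω ε).jumpMap (hit τbar ω (ξ j))

/-- The time at which the `j`-th jump takes place (`0` for `j = 0`). -/
def jumpTime (τbar ω : ℝ) (ξ : ℕ → EuclideanSpace ℝ (Fin N)) (j : ℕ) : ℝ :=
  ∑ k ∈ Finset.range j, hitTime τbar ω (ξ k)

/-- The solution that starts at `ξ 0` and jumps to `ξ 1`, `ξ 2`, …. -/
def arc (τbar ω : ℝ) (ξ : ℕ → EuclideanSpace ℝ (Fin N)) : HybridFun (EuclideanSpace ℝ (Fin N)) where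
  dom := {p | jumpTime τbar ω ξ p.2 ≤ p.1 ∧ p.1 ≤ jumpTime τbar ω ξ (p.2 + 1)}
  toFun t j := flow ω (ξ j) (t - jumpTime τbar ω ξ j)

theorem jumpTime_succ (ξ : ℕ → EuclideanSpace ℝ (Fin N)) (j : ℕ) :
    jumpTime τbar ω ξ (j + 1) = jumpTime τbar ω ξ j + hitTime τbar ω (ξ j) :=
  Finset.sum_range_succ _ _

@[simp] theorem jumpTime_zero (ξ : ℕ → EuclideanSpace ℝ (Fin N)) : jumpTime τbar ω ξ 0 = 0 :=
  Finset.sum_range_zero _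

theorem IsJumpSeq.mem_cube (hN : 0 < N) (hω : 0 < ω) (hε : -1 < ε) (hε' : ε < 0)
    {ξ : ℕ → EuclideanSpace ℝ (Fin N)} (h : IsJumpSeq τbar ω ε ξ) (j : ℕ) : ξ j ∈ cube N τbar := by
  induction j with
  | zero => exact h.1
  | succ j ih => exact jumpMap_subset_cube hε hε' (hit_mem_jumpSet hN hω ih) (h.2 j)

theorem IsJumpSeq.monotone_jumpTime (hN : 0 < N) (hω : 0 < ω) (hε : -1 < ε) (hε' : ε < 0)
    {ξ : ℕ → EuclideanSpace ℝ (Fin N)} (h : IsJumpSeq τbar ω ε ξ) :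
    Monotone (jumpTime τbar ω ξ) :=
  monotone_nat_of_le_succ fun j => by
    rw [jumpTime_succ]
    linarith [hitTime_nonneg hN hω (h.mem_cube hN hω hε hε' j)]

theorem IsJumpSeq.jumpTime_le (hN : 0 < N) (hω : 0 < ω) (hε : -1 < ε) (hε' : ε < 0)
    {ξ : ℕ → EuclideanSpace ℝ (Fin N)} (h : IsJumpSeq τbar ω ε ξ) (j : ℕ) :
    jumpTime τbar ω ξ j ≤ j * (τbar / ω) := by
  rw [jumpTime, ← nsmul_eq_mul, ← Finset.card_range j]
  refine (Finset.sum_le_card_nsmul _ _ _ fun k _ =>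
    hitTime_le hN hω (h.mem_cube hN hω hε hε' k)).trans_eq ?_
  simp

theorem hit_eq_flow_jumpTime (ξ : ℕ → EuclideanSpace ℝ (Fin N)) (j : ℕ) :
    (arc τbar ω ξ).toFun (jumpTime τbar ω ξ (j + 1)) j = hit τbar ω (ξ j) := by
  simp [arc, hit, jumpTime_succ]

theorem IsJumpSeq.jumpTime_mem_arc_dom (hN : 0 < N) (hω : 0 < ω) (hε : -1 < ε) (hε' : ε < 0)
    {ξ : ℕ → EuclideanSpace ℝ (Fin N)} (h : IsJumpSeq τbar ω ε ξ) (j : ℕ) :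
    (jumpTime τbar ω ξ j, j) ∈ (arc τbar ω ξ).dom :=
  ⟨le_rfl, h.monotone_jumpTime hN hω hε hε' j.le_succ⟩

theorem IsJumpSeq.arc_mem_cube (hN : 0 < N) (hω : 0 < ω) (hε : -1 < ε) (hε' : ε < 0)
    {ξ : ℕ → EuclideanSpace ℝ (Fin N)} (h : IsJumpSeq τbar ω ε ξ) {t : ℝ} {j : ℕ}
    (ht : (t, j) ∈ (arc τbar ω ξ).dom) : (arc τbar ω ξ).toFun t j ∈ cube N τbar := by
  have h2 : t ≤ jumpTime τbar ω ξ (j + 1) := ht.2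
  rw [jumpTime_succ] at h2
  exact flow_mem_cube hN hω (h.mem_cube hN hω hε hε' j) (sub_nonneg.2 ht.1) (by linarith)

theorem hasDerivAt_flow_sub (τ : EuclideanSpace ℝ (Fin N)) (a t : ℝ) :
    HasDerivAt (fun s => flow ω τ (s - a)) (WithLp.toLp 2 (fun _ => ω)) t := by
  have h := (((hasDerivAt_id t).sub_const a).smul_const
    (WithLp.toLp 2 (fun _ => ω) : EuclideanSpace ℝ (Fin N))).const_add τ
  simpa [flow] using h

theorem absolutelyContinuousOnInterval_flow_sub (τ : EuclideanSpace ℝ (Fin N)) (c a b : ℝ) :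
    AbsolutelyContinuousOnInterval (fun s => flow ω τ (s - c)) a b := by
  refine LipschitzOnWith.absolutelyContinuousOnInterval
    (K := ‖(WithLp.toLp 2 (fun _ => ω) : EuclideanSpace ℝ (Fin N))‖₊) ?_
  refine LipschitzWith.lipschitzOnWith (LipschitzWith.of_dist_le_mul fun x y => ?_)
  rw [flow, flow, dist_add_left, dist_eq_norm, ← sub_smul, norm_smul, sub_sub_sub_cancel_right,
    mul_comm, Real.dist_eq, Real.norm_eq_abs, coe_nnnorm]

theorem IsJumpSeq.isSolution_arc (hN : 0 < N) (hω : 0 < ω) (hε : -1 < ε) (hε' : ε < 0)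
    {ξ : ℕ → EuclideanSpace ℝ (Fin N)} (h : IsJumpSeq τbar ω ε ξ) :
    (arc τbar ω ξ).IsSolution (system N τbar ω ε) := by
  have hmono := h.monotone_jumpTime hN hω hε hε'
  have h00 : ((0 : ℝ), 0) ∈ (arc τbar ω ξ).dom := by
    simpa using h.jumpTime_mem_arc_dom hN hω hε hε' 0
  refine ⟨⟨isHybridTimeDomain_of_monotone (jumpTime_zero ξ) hmono, fun j a b _ _ =>
    absolutelyContinuousOnInterval_flow_sub _ _ _ _⟩, h00,
    Or.inl (h.arc_mem_cube hN hω hε hε' h00), fun j => Eventually.of_forall fun t ht =>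
    ⟨h.arc_mem_cube hN hω hε hε' ht, (hasDerivAt_flow_sub _ _ _).hasDerivWithinAt⟩, ?_⟩
  intro t j h1 h2
  have ht : t = jumpTime τbar ω ξ (j + 1) := le_antisymm h1.2 h2.1
  rw [ht, hit_eq_flow_jumpTime]
  refine ⟨hit_mem_jumpSet hN hω (h.mem_cube hN hω hε hε' j), ?_⟩
  simpa [arc, flow] using h.2 j

theorem IsJumpSeq.isComplete_arc (hN : 0 < N) (hω : 0 < ω) (hε : -1 < ε) (hε' : ε < 0)
    {ξ : ℕ → EuclideanSpace ℝ (Fin N)} (h : IsJumpSeq τbar ω ε ξ) :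
    (arc τbar ω ξ).IsComplete := by
  intro hb
  obtain ⟨R, hR⟩ := hb.subset_closedBall (0, 0)
  obtain ⟨n, hn⟩ := exists_nat_gt R
  have h1 := hR (h.jumpTime_mem_arc_dom hN hω hε hε' n)
  rw [Metric.mem_closedBall, Prod.dist_eq] at h1
  have h2 : dist n 0 ≤ R := (le_max_right _ _).trans h1
  rw [Nat.dist_eq] at h2
  simp at h2
  linarith

/-! ### Every solution follows a sequence of jumps -/

/-- Along an interval of flow, a solution moves with the constant velocity `ω 𝟏`. -/
theorem toFun_eq_flow_of_isSolution {x : HybridFun (EuclideanSpace ℝ (Fin N))}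
    (hx : x.IsSolution (system N τbar ω ε)) {a b : ℝ} {j : ℕ} (hab : a ≤ b)
    (ha : (a, j) ∈ x.dom) (hb : (b, j) ∈ x.dom) :
    x.toFun b j = flow ω (x.toFun a j) (b - a) := by
  have hsub : ∀ u ∈ Icc a b, (u, j) ∈ x.dom := fun u hu => hx.1.1.Icc_subset ha hb hu
  have hac := (hx.1.2 j a b hab hsub).sub
    (absolutelyContinuousOnInterval_flow_sub (ω := ω) (0 : EuclideanSpace ℝ (Fin N)) 0 a b)
  have hne : ∀ c : ℝ, ∀ᵐ u ∂(volume : Measure ℝ), u ≠ c := fun c =>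
    compl_mem_ae_iff.2 (measure_singleton c)
  obtain ⟨c, hc⟩ := hac.const_of_ae_hasDerivAt_zero (by
    filter_upwards [hx.2.2.2.1 j, hne a, hne b] with u hu hua hub huab
    rw [uIcc_of_le hab] at huab
    have hnhds : x.slice j ∈ 𝓝 u := mem_of_superset
      (Icc_mem_nhds (lt_of_le_of_ne huab.1 hua.symm) (lt_of_le_of_ne huab.2 hub)) hsub
    have := ((hu (hsub u huab)).2.hasDerivAt hnhds).sub
      (hasDerivAt_flow_sub (ω := ω) (0 : EuclideanSpace ℝ (Fin N)) 0 u)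
    simpa [system] using! this)
  have h := (hc b right_mem_uIcc).trans (hc a left_mem_uIcc).symm
  simp only [Pi.sub_apply, flow, sub_zero, zero_add] at h
  rw [flow, sub_smul]
  rw [sub_eq_iff_eq_add] at h
  rw [h]
  abel

/-- As long as a solution flows from a state of the cube, it stays in the cube. -/
theorem toFun_mem_cube_of_isSolution (hω : 0 < ω) {x : HybridFun (EuclideanSpace ℝ (Fin N))}
    (hx : x.IsSolution (system N τbar ω ε)) {a b : ℝ} {j : ℕ} (hab : a ≤ b)
    (ha : (a, j) ∈ x.dom) (hb : (b, j) ∈ x.dom) (hxa : x.toFun a j ∈ cube N τbar) :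
    x.toFun b j ∈ cube N τbar := by
  rcases hab.eq_or_lt with rfl | hab'
  · exact hxa
  intro i
  have hxb := toFun_eq_flow_of_isSolution hx hab ha hb
  refine ⟨?_, ?_⟩
  · rw [hxb, flow_apply]
    have := mul_nonneg (sub_nonneg.2 hab) hω.le
    linarith [(hxa i).1]
  · by_contra! hc
    -- the state exceeds the threshold already slightly before the time `b`
    obtain ⟨u, hu, hu'⟩ := exists_mem_Ioo_of_ae (hx.2.2.2.1 j)
      (max_lt hab' (sub_lt_self b (div_pos (sub_pos.2 hc) hω)))
    rw [mem_Ioo, max_lt_iff] at hu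
    have hdom : (u, j) ∈ x.dom := hx.1.1.Icc_subset ha hb ⟨hu.1.1.le, hu.2.le⟩
    have h1 := ((hu' hdom).1 i).2
    have h2 := congrArg (fun v => v i) (toFun_eq_flow_of_isSolution hx hu.2.le hdom hb)
    simp only [flow_apply] at h2
    have h3 := hu.1.2
    rw [sub_lt_comm, lt_div_iff₀ hω] at h3
    linarith

theorem jumpMap_nonempty {τ : EuclideanSpace ℝ (Fin N)} (hτ : τ ∈ jumpSet N τbar) :
    ((system N τbar ω ε).jumpMap τ).Nonempty := by
  have h : ∀ i, (jumpComponent τbar ε i τ).Nonempty := by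
    intro i
    obtain ⟨k, hk⟩ := hτ.2
    rcases (hτ.1 i).2.eq_or_lt with hi | hi
    · by_cases hr : ∃ r, r ≠ i ∧ τ r = τbar
      · exact ⟨0, Or.inr (Or.inl ⟨hi, hr, Or.inl rfl⟩)⟩
      · push Not at hr
        exact ⟨0, Or.inl ⟨hi, fun r hri => lt_of_le_of_ne (hτ.1 r).2 (hr r hri), rfl⟩⟩
    · exact ⟨_, Or.inr (Or.inr ⟨hi, ⟨k, by rintro rfl; exact hi.ne hk, hk⟩, rfl⟩)⟩
  choose y hy using h
  exact ⟨WithLp.toLp 2 y, hy⟩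

/-- Every solution is the restriction of a solution that never stops jumping. Where the given
solution has ended, the jumps are continued arbitrarily. -/
theorem exists_isJumpSeq_of_isSolution (hN : 0 < N) (hω : 0 < ω) (hε : -1 < ε) (hε' : ε < 0)
    {x : HybridFun (EuclideanSpace ℝ (Fin N))} (hx : x.IsSolution (system N τbar ω ε)) :
    ∃ ξ : ℕ → EuclideanSpace ℝ (Fin N), IsJumpSeq τbar ω ε ξ ∧ ξ 0 = x.toFun 0 0 ∧
      x.dom ⊆ (arc τbar ω ξ).dom ∧
      ∀ t j, (t, j) ∈ x.dom → x.toFun t j = (arc τbar ω ξ).toFun t j := by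
  classical
  have hx0 : x.toFun 0 0 ∈ cube N τbar := by
    rcases hx.2.2.1 with h | h
    exacts [h, h.1]
  let g : EuclideanSpace ℝ (Fin N) → EuclideanSpace ℝ (Fin N) := fun τ =>
    if h : ((system N τbar ω ε).jumpMap τ).Nonempty then h.some else 0
  -- the pair of the `j`-th jump time and the state right after that jump
  let P : ℕ → ℝ × EuclideanSpace ℝ (Fin N) := fun j => Nat.rec (0, x.toFun 0 0)
    (fun j p => (p.1 + hitTime τbar ω p.2,
      if (p.1 + hitTime τbar ω p.2, j) ∈ x.dom ∧ (p.1 + hitTime τbar ω p.2, j + 1) ∈ x.dom ∧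
          x.toFun (p.1 + hitTime τbar ω p.2) j = hit τbar ω p.2
        then x.toFun (p.1 + hitTime τbar ω p.2) (j + 1) else g (hit τbar ω p.2))) j
  let ξ : ℕ → EuclideanSpace ℝ (Fin N) := fun j => (P j).2
  have hP : ∀ j, (P j).1 = jumpTime τbar ω ξ j := by
    intro j
    induction j with
    | zero => simp [P]
    | succ j ih => rw [jumpTime_succ, ← ih]
  have hξ : ∀ j, ξ (j + 1) = if (jumpTime τbar ω ξ (j + 1), j) ∈ x.dom ∧
      (jumpTime τbar ω ξ (j + 1), j + 1) ∈ x.dom ∧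
        x.toFun (jumpTime τbar ω ξ (j + 1)) j = hit τbar ω (ξ j)
        then x.toFun (jumpTime τbar ω ξ (j + 1)) (j + 1) else g (hit τbar ω (ξ j)) := by
    intro j
    rw [jumpTime_succ, ← hP]
  have hstep : ∀ j, ξ j ∈ cube N τbar →
      ξ (j + 1) ∈ (system N τbar ω ε).jumpMap (hit τbar ω (ξ j)) := by
    intro j hj
    rw [hξ]
    split_ifs with hc
    · rw [← hc.2.2]
      exact (hx.2.2.2.2 _ _ hc.1 hc.2.1).2
    · have := jumpMap_nonempty (ω := ω) (ε := ε) (hit_mem_jumpSet hN hω hj)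
      simp only [g, this, dif_pos]
      exact this.some_mem
  have hcube : ∀ j, ξ j ∈ cube N τbar := by
    intro j
    induction j with
    | zero => exact hx0
    | succ j ih => exact jumpMap_subset_cube hε hε' (hit_mem_jumpSet hN hω ih) (hstep j ih)
  have hseq : IsJumpSeq τbar ω ε ξ := ⟨hx0, fun j => hstep j (hcube j)⟩
  -- a flow from the `j`-th jump on cannot last beyond the next one
  have hflow : ∀ j t, jumpTime τbar ω ξ j ≤ t → (jumpTime τbar ω ξ j, j) ∈ x.dom →
      x.toFun (jumpTime τbar ω ξ j) j = ξ j → (t, j) ∈ x.dom →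
      (t, j) ∈ (arc τbar ω ξ).dom ∧ x.toFun t j = (arc τbar ω ξ).toFun t j := by
    intro j t h1 h2 h3 h4
    have h5 := toFun_eq_flow_of_isSolution hx h1 h2 h4
    have h6 := toFun_mem_cube_of_isSolution hω hx h1 h2 h4 (h3 ▸ hcube j)
    rw [h3] at h5
    refine ⟨⟨h1, ?_⟩, h5⟩
    have h7 : t - jumpTime τbar ω ξ j ≤ hitTime τbar ω (ξ j) :=
      (le_hitTime_iff hN hω _ _).2 fun i => h5 ▸ (h6 i).2
    change t ≤ jumpTime τbar ω ξ (j + 1)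
    rw [jumpTime_succ]
    linarith
  have key : ∀ j t, (t, j) ∈ x.dom →
      (t, j) ∈ (arc τbar ω ξ).dom ∧ x.toFun t j = (arc τbar ω ξ).toFun t j := by
    intro j
    induction j with
    | zero =>
      intro t ht
      exact hflow 0 t (by simpa using hx.1.1.1 _ ht) (by simpa using hx.2.1)
        (by simp [ξ, P]) ht
    | succ j ih =>
      intro t ht
      obtain ⟨s, hst, hs, hs'⟩ := hx.1.1.exists_jump_le ht
      obtain ⟨h1, h2⟩ := ih s hs
      have hsj : s = jumpTime τbar ω ξ (j + 1) := by
        refine le_antisymm h1.2 ?_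
        obtain ⟨i, hi⟩ := (hx.2.2.2.2 s j hs hs').1.2
        rw [h2] at hi
        have := hitTime_le_of_flow_eq hN hω hi
        rw [jumpTime_succ]
        linarith
      rw [hsj] at hst hs hs' h2
      rw [hit_eq_flow_jumpTime] at h2
      exact hflow (j + 1) t hst hs' (by rw [hξ, if_pos ⟨hs, hs', h2⟩]) ht
  exact ⟨ξ, hseq, rfl, fun p hp => (key p.2 p.1 hp).1, fun t j h => (key j t h).2⟩

theorem IsJumpSeq.isMaximalSolution_arc (hN : 0 < N) (hω : 0 < ω) (hε : -1 < ε) (hε' : ε < 0)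
    {ξ : ℕ → EuclideanSpace ℝ (Fin N)} (h : IsJumpSeq τbar ω ε ξ) :
    (arc τbar ω ξ).IsMaximalSolution (system N τbar ω ε) := by
  refine ⟨h.isSolution_arc hN hω hε hε', ?_⟩
  rintro ⟨y, hy, hss, -⟩
  obtain ⟨ζ, hζ, -, hsub, -⟩ := exists_isJumpSeq_of_isSolution hN hω hε hε' hy
  refine hss.not_subset (hsub.trans ?_)
  have hle := hss.subset.trans hsub
  have heq : ∀ j, jumpTime τbar ω ξ j = jumpTime τbar ω ζ j := by
    intro j
    cases j with
    | zero => simp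
    | succ j =>
      have h1 : (jumpTime τbar ω ξ (j + 1), j) ∈ (arc τbar ω ξ).dom :=
        ⟨h.monotone_jumpTime hN hω hε hε' j.le_succ, le_rfl⟩
      exact le_antisymm (hle h1).2 (hle (h.jumpTime_mem_arc_dom hN hω hε hε' (j + 1))).1
  rintro p ⟨h1, h2⟩
  rw [← heq] at h1 h2
  exact ⟨h1, h2⟩

theorem isComplete_of_isMaximalSolution (hN : 0 < N) (hω : 0 < ω) (hε : -1 < ε) (hε' : ε < 0)
    {x : HybridFun (EuclideanSpace ℝ (Fin N))}
    (hx : x.IsMaximalSolution (system N τbar ω ε)) : x.IsComplete := by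
  obtain ⟨ξ, hξ, -, hsub, heq⟩ := exists_isJumpSeq_of_isSolution hN hω hε hε' hx.1
  have hdom : x.dom = (arc τbar ω ξ).dom := by
    by_contra hne
    exact hx.2 ⟨_, hξ.isSolution_arc hN hω hε hε', hsub.ssubset_of_ne hne, heq⟩
  have := hξ.isComplete_arc hN hω hε hε'
  rwa [HybridFun.IsComplete, ← hdom] at this


/-! ### The sorted desynchronized point -/

/-- The smallest entry of the sorted desynchronized point. -/
def bottomLevel (N : ℕ) (τbar ε : ℝ) : ℝ := τbar / ∑ p ∈ Finset.range N, (ε + 1) ^ p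

theorem sum_pow_pos (hN : 0 < N) (hε : -1 < ε) : 0 < ∑ p ∈ Finset.range N, (ε + 1) ^ p :=
  Finset.sum_pos (fun p _ => pow_pos (by linarith) p) ⟨0, by simpa using hN⟩

theorem bottomLevel_pos (hN : 0 < N) (hτ : 0 < τbar) (hε : -1 < ε) : 0 < bottomLevel N τbar ε :=
  div_pos hτ (sum_pow_pos hN hε)

theorem sortedPoint_eq (k : Fin N) : sortedPoint N τbar ε k =
    (∑ p ∈ Finset.range (N - (k : ℕ)), (ε + 1) ^ p) * bottomLevel N τbar ε := by
  rw [sortedPoint, bottomLevel, div_mul_eq_mul_div, mul_div_assoc]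

theorem sortedPoint_of_val_eq_zero (hε : -1 < ε) {k : Fin N} (hk : (k : ℕ) = 0) :
    sortedPoint N τbar ε k = τbar := by
  rw [sortedPoint, hk, Nat.sub_zero, div_self (sum_pow_pos k.pos hε).ne', one_mul]

theorem sortedPoint_of_val_eq_last {k : Fin N} (hk : (k : ℕ) = N - 1) :
    sortedPoint N τbar ε k = bottomLevel N τbar ε := by
  have : N - (k : ℕ) = 1 := by have := k.2; omega
  rw [sortedPoint_eq, this]
  simp

/-- Passing to the next higher level multiplies by `1 + ε` and adds the bottom level. -/
theorem sortedPoint_of_val_succ {k l : Fin N} (h : (l : ℕ) = k + 1) :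
    sortedPoint N τbar ε k = (1 + ε) * sortedPoint N τbar ε l + bottomLevel N τbar ε := by
  have h1 : N - (k : ℕ) = N - (l : ℕ) + 1 := by have := l.2; omega
  rw [sortedPoint_eq, sortedPoint_eq, h1, geom_sum_succ]
  ring

theorem bottomLevel_le_sortedPoint (hτ : 0 < τbar) (hε : -1 < ε) (k : Fin N) :
    bottomLevel N τbar ε ≤ sortedPoint N τbar ε k := by
  rw [sortedPoint_eq]
  refine le_mul_of_one_le_left (bottomLevel_pos k.pos hτ hε).le ?_
  have h : N - (k : ℕ) = N - (k : ℕ) - 1 + 1 := by have := k.2; omega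
  rw [h, geom_sum_succ]
  have := Finset.sum_nonneg (s := Finset.range (N - (k : ℕ) - 1))
    fun p _ => pow_nonneg (show 0 ≤ ε + 1 by linarith) p
  nlinarith

/-- The levels of the sorted desynchronized point are uniformly separated from each other and
from `0`. -/
theorem exists_pos_le_sortedPoint_sub (hN : 0 < N) (hτ : 0 < τbar) (hε : -1 < ε) (hε' : ε < 0) :
    ∃ γ > 0, (∀ k l : Fin N, k < l → γ ≤ sortedPoint N τbar ε k - sortedPoint N τbar ε l) ∧
      ∀ k : Fin N, γ ≤ sortedPoint N τbar ε k := by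
  have hc := bottomLevel_pos hN hτ hε
  have hq : 0 < ε + 1 := by linarith
  refine ⟨(ε + 1) ^ N * bottomLevel N τbar ε, by positivity, fun k l hkl => ?_, fun k => ?_⟩
  · rw [sortedPoint_eq, sortedPoint_eq, ← sub_mul]
    refine mul_le_mul_of_nonneg_right ?_ hc.le
    have h1 : N - (l : ℕ) + 1 ≤ N - (k : ℕ) := by have := l.2; have : (k : ℕ) < l := hkl; omega
    have h2 := Finset.sum_le_sum_of_subset_of_nonneg (Finset.range_mono h1)
      fun p _ _ => pow_nonneg hq.le p
    rw [Finset.sum_range_succ] at h2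
    have h3 : (ε + 1) ^ N ≤ (ε + 1) ^ (N - (l : ℕ)) :=
      pow_le_pow_of_le_one hq.le (by linarith) (Nat.sub_le _ _)
    linarith
  · exact (mul_le_of_le_one_left hc.le (pow_le_one₀ hq.le (by linarith))).trans
      (bottomLevel_le_sortedPoint hτ hε k)

theorem sortedPoint_le (hτ : 0 < τbar) (hε : -1 < ε) (k : Fin N) :
    sortedPoint N τbar ε k ≤ τbar := by
  refine le_of_le_of_eq ?_
    (sortedPoint_of_val_eq_zero (N := N) (τbar := τbar) hε (k := ⟨0, k.pos⟩) rfl)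
  rw [sortedPoint_eq, sortedPoint_eq]
  refine mul_le_mul_of_nonneg_right ?_ (bottomLevel_pos k.pos hτ hε).le
  exact Finset.sum_le_sum_of_subset_of_nonneg 
    (Finset.range_mono (Nat.sub_le_sub_left (Nat.zero_le _) _))
    fun p _ _ => pow_nonneg (show 0 ≤ ε + 1 by linarith) p

/-! ### The distance to the desynchronization set -/

/-- The point with shift `s` of the (unbounded) line that carries `ℓ_σ`. -/
def linePoint (τbar ε : ℝ) (σ : Equiv.Perm (Fin N)) (s : ℝ) : EuclideanSpace ℝ (Fin N) :=
  WithLp.toLp 2 fun i => sortedPoint N τbar ε (σ i) + s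

theorem desyncLine_eq_image (hN : 0 < N) (hτ : 0 < τbar) (hε : -1 < ε)
    (σ : Equiv.Perm (Fin N)) :
    desyncLine N τbar ε σ = linePoint τbar ε σ '' Icc (-bottomLevel N τbar ε) 0 := by
  ext τ
  constructor
  · rintro ⟨hc, s, hs⟩
    refine ⟨s, ⟨?_, ?_⟩, ?_⟩
    · have h1 := (hc (σ.symm ⟨N - 1, by omega⟩)).1
      rw [hs, Equiv.apply_symm_apply, sortedPoint_of_val_eq_last rfl] at h1
      linarith
    · have h1 := (hc (σ.symm ⟨0, hN⟩)).2
      rw [hs, Equiv.apply_symm_apply, sortedPoint_of_val_eq_zero hε rfl] at h1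
      linarith
    · ext i
      simp [linePoint, hs]
  · rintro ⟨s, hs, rfl⟩
    refine ⟨fun i => ?_, s, fun i => by simp [linePoint]⟩
    have h1 := bottomLevel_le_sortedPoint hτ hε (σ i)
    have h2 := sortedPoint_le hτ hε (σ i)
    simp only [linePoint]
    exact ⟨by linarith [hs.1], by linarith [hs.2]⟩

theorem isCompact_desyncSet (hN : 0 < N) (hτ : 0 < τbar) (hε : -1 < ε) :
    IsCompact (desyncSet N τbar ε) := by
  refine isCompact_iUnion fun σ => ?_
  rw [desyncLine_eq_image hN hτ hε]
  refine isCompact_Icc.image ?_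
  unfold linePoint
  fun_prop

theorem desyncSet_nonempty (hN : 0 < N) (hτ : 0 < τbar) (hε : -1 < ε) :
    (desyncSet N τbar ε).Nonempty := by
  refine ⟨linePoint τbar ε 1 0, mem_iUnion.2 ⟨1, ?_⟩⟩
  rw [desyncLine_eq_image hN hτ hε]
  exact mem_image_of_mem _ (right_mem_Icc.2 (neg_nonpos.2 (bottomLevel_pos hN hτ hε).le))

/-- The deviation of the timer `i` from its level when `σ i` is the rank of `i` in the descending
order of the timers. -/
def deviation (τbar ε : ℝ) (σ : Equiv.Perm (Fin N)) (τ : EuclideanSpace ℝ (Fin N)) (i : Fin N) :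
    ℝ :=
  τ i - sortedPoint N τbar ε (σ i)

/-- The deviations of all timers differ by at most `δ`: in the sup norm, `τ` is at distance at most
`δ / 2` from the line `τ̃ + ℝ 𝟏` that carries `ℓ_σ`. -/
def SpreadLE (τbar ε : ℝ) (σ : Equiv.Perm (Fin N)) (τ : EuclideanSpace ℝ (Fin N)) (δ : ℝ) : Prop :=
  ∀ i r, deviation τbar ε σ τ i - deviation τbar ε σ τ r ≤ δ

theorem norm_le_card_mul {v : EuclideanSpace ℝ (Fin N)} {δ : ℝ} (h : ∀ i, |v i| ≤ δ) :
    ‖v‖ ≤ N * δ := by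
  have h1 : ‖v‖ ≤ ∑ i, |v i| := by
    rw [EuclideanSpace.norm_eq]
    refine Real.sqrt_le_iff.2 ⟨Finset.sum_nonneg fun i _ => abs_nonneg _, ?_⟩
    simp only [Real.norm_eq_abs]
    exact Finset.sum_sq_le_sq_sum_of_nonneg fun i _ => abs_nonneg _
  refine h1.trans ((Finset.sum_le_card_nsmul _ _ _ fun i _ => h i).trans_eq ?_)
  simp

theorem infDist_desyncSet_le (hN : 0 < N) (hτ : 0 < τbar) (hε : -1 < ε)
    {τ : EuclideanSpace ℝ (Fin N)} (hc : τ ∈ cube N τbar) {σ : Equiv.Perm (Fin N)} {δ : ℝ}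
    (h : SpreadLE τbar ε σ τ δ) : Metric.infDist τ (desyncSet N τbar ε) ≤ N * δ := by
  -- any deviation serves as shift, once it is clamped to the shifts that stay in the cube
  obtain ⟨s, hs, hs'⟩ : ∃ s ∈ Icc (-bottomLevel N τbar ε) 0,
      ∀ i, |deviation τbar ε σ τ i - s| ≤ δ := by
    set w := deviation τbar ε σ τ with hw
    set t := σ.symm ⟨0, hN⟩
    set b := σ.symm ⟨N - 1, by omega⟩
    have ht : w t ≤ 0 := by
      simp only [hw, deviation, t, Equiv.apply_symm_apply]
      rw [sortedPoint_of_val_eq_zero hε rfl]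
      linarith [(hc (σ.symm ⟨0, hN⟩)).2]
    have hb : -bottomLevel N τbar ε ≤ w b := by
      simp only [hw, deviation, b, Equiv.apply_symm_apply]
      rw [sortedPoint_of_val_eq_last rfl]
      linarith [(hc (σ.symm ⟨N - 1, by omega⟩)).1]
    have hcpos := bottomLevel_pos hN hτ hε
    by_cases h1 : w t < -bottomLevel N τbar ε
    · refine ⟨_, left_mem_Icc.2 (by linarith), fun i => abs_le.2 ⟨?_, ?_⟩⟩
      · linarith [h b i]
      · linarith [h i t]
    · exact ⟨w t, ⟨not_lt.1 h1, ht⟩, fun i => abs_le.2 ⟨by linarith [h t i], h i t⟩⟩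
  have hz : linePoint τbar ε σ s ∈ desyncSet N τbar ε :=
    mem_iUnion.2 ⟨σ, by rw [desyncLine_eq_image hN hτ hε]; exact mem_image_of_mem _ hs⟩
  refine (Metric.infDist_le_dist_of_mem hz).trans ?_
  rw [dist_eq_norm]
  refine norm_le_card_mul fun i => ?_
  have := hs' i
  rwa [deviation, sub_sub] at this

theorem exists_spreadLE_of_infDist_le (hN : 0 < N) (hτ : 0 < τbar) (hε : -1 < ε)
    {τ : EuclideanSpace ℝ (Fin N)} {δ : ℝ} (h : Metric.infDist τ (desyncSet N τbar ε) ≤ δ) :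
    ∃ σ, SpreadLE τbar ε σ τ (2 * δ) := by
  obtain ⟨z, hz, hd⟩ := (isCompact_desyncSet hN hτ hε).exists_infDist_eq_dist
    (desyncSet_nonempty hN hτ hε) τ
  obtain ⟨σ, -, s, hs⟩ := mem_iUnion.1 hz
  refine ⟨σ, fun i r => ?_⟩
  have hle : ∀ i, |τ i - z i| ≤ δ := fun i => by
    have := PiLp.norm_apply_le (τ - z) i
    rw [← dist_eq_norm, ← hd] at this
    simpa using this.trans h
  have h1 := abs_le.1 (hle i)
  have h2 := abs_le.1 (hle r)
  rw [hs] at h1 h2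
  simp only [deviation]
  linarith [h1.2, h2.1]

theorem exists_spreadLE (σ : Equiv.Perm (Fin N)) (τ : EuclideanSpace ℝ (Fin N)) :
    ∃ δ, SpreadLE τbar ε σ τ δ := by
  obtain ⟨δ, hδ⟩ := (Set.finite_range fun p : Fin N × Fin N =>
    deviation τbar ε σ τ p.1 - deviation τbar ε σ τ p.2).bddAbove
  exact ⟨δ, fun i r => hδ ⟨(i, r), rfl⟩⟩

/-! ### Rankings of the timers -/

/-- The ranks after a jump: the top timer goes to the bottom, the others move up by one. -/
def promote (σ : Equiv.Perm (Fin N)) : Equiv.Perm (Fin N) := σ.trans (finRotate N).symm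

theorem promote_val_of_eq_zero {σ : Equiv.Perm (Fin N)} {i : Fin N} (h : (σ i : ℕ) = 0) :
    (promote σ i : ℕ) = N - 1 := by
  obtain ⟨n, rfl⟩ : ∃ n, N = n + 1 := ⟨N - 1, by have := i.pos; omega⟩
  have h0 : σ i = 0 := Fin.ext h
  have : promote σ i = Fin.last n := by
    rw [promote, Equiv.trans_apply, h0, Equiv.symm_apply_eq, finRotate_last]
  rw [this]
  simp

theorem promote_val_of_ne_zero {σ : Equiv.Perm (Fin N)} {i : Fin N} (h : (σ i : ℕ) ≠ 0) :
    (promote σ i : ℕ) = σ i - 1 := by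
  have : NeZero N := ⟨i.pos.ne'⟩
  exact coe_finRotate_symm_of_ne_zero fun h0 => h (by simp [h0])

/-- `σ` ranks the timers in descending order, ties being ranked in any way. -/
def IsRanking (σ : Equiv.Perm (Fin N)) (τ : EuclideanSpace ℝ (Fin N)) : Prop :=
  ∀ i r, σ i ≤ σ r → τ r ≤ τ i

/-- `σ` ranks the timers in descending order and there are no ties. -/
def IsStrictRanking (σ : Equiv.Perm (Fin N)) (τ : EuclideanSpace ℝ (Fin N)) : Prop :=
  ∀ i r, σ i < σ r → τ r < τ i

theorem IsStrictRanking.isRanking {σ : Equiv.Perm (Fin N)} {τ : EuclideanSpace ℝ (Fin N)}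
    (h : IsStrictRanking σ τ) : IsRanking σ τ := by
  intro i r hir
  rcases hir.eq_or_lt with h' | h'
  · rw [σ.injective h']
  · exact (h i r h').le

theorem exists_isRanking (τ : EuclideanSpace ℝ (Fin N)) : ∃ σ, IsRanking σ τ := by
  refine ⟨(Tuple.sort fun i => -τ i).symm, fun i r h => ?_⟩
  have := Tuple.monotone_sort (fun i => -τ i) h
  simpa using this

theorem IsRanking.isStrictRanking {σ : Equiv.Perm (Fin N)} {τ : EuclideanSpace ℝ (Fin N)}
    (h : IsRanking σ τ) (hτ : ∀ i r, i ≠ r → τ i ≠ τ r) : IsStrictRanking σ τ := fun i r hir =>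
  lt_of_le_of_ne (h i r hir.le) (hτ r i fun e => hir.ne (by rw [e]))

theorem IsRanking.flow {σ : Equiv.Perm (Fin N)} {τ : EuclideanSpace ℝ (Fin N)}
    (h : IsRanking σ τ) (s : ℝ) : IsRanking σ (flow ω τ s) := fun i r hir => by
  simpa using h i r hir

theorem IsStrictRanking.flow {σ : Equiv.Perm (Fin N)} {τ : EuclideanSpace ℝ (Fin N)}
    (h : IsStrictRanking σ τ) (s : ℝ) : IsStrictRanking σ (flow ω τ s) := fun i r hir => by
  simpa using h i r hir

theorem SpreadLE.flow {σ : Equiv.Perm (Fin N)} {τ : EuclideanSpace ℝ (Fin N)} {δ : ℝ}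
    (h : SpreadLE τbar ε σ τ δ) (s : ℝ) : SpreadLE τbar ε σ (flow ω τ s) δ := fun i r => by
  have := h i r
  simp only [deviation, flow_apply] at this ⊢
  linarith

theorem IsRanking.eq_of_val_eq_zero {σ : Equiv.Perm (Fin N)} {τ : EuclideanSpace ℝ (Fin N)}
    (h : IsRanking σ τ) (hD : τ ∈ jumpSet N τbar) {i : Fin N} (hi : (σ i : ℕ) = 0) :
    τ i = τbar := by
  obtain ⟨k, hk⟩ := hD.2
  refine le_antisymm (hD.1 i).2 (hk ▸ h i k ?_)
  rw [Fin.le_def, hi]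
  exact Nat.zero_le _

/-- The jump successor in which the timer of rank zero, and no other one, is reset. -/
def resetTop (ε : ℝ) (σ : Equiv.Perm (Fin N)) (τ : EuclideanSpace ℝ (Fin N)) :
    EuclideanSpace ℝ (Fin N) :=
  WithLp.toLp 2 fun i => if (σ i : ℕ) = 0 then 0 else (1 + ε) * τ i

theorem resetTop_apply_of_eq_zero {σ : Equiv.Perm (Fin N)} (τ : EuclideanSpace ℝ (Fin N))
    {i : Fin N} (h : (σ i : ℕ) = 0) : resetTop ε σ τ i = 0 := by
  simp [resetTop, h]

theorem resetTop_apply_of_ne_zero {σ : Equiv.Perm (Fin N)} (τ : EuclideanSpace ℝ (Fin N))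
    {i : Fin N} (h : (σ i : ℕ) ≠ 0) : resetTop ε σ τ i = (1 + ε) * τ i := by
  simp only [resetTop, if_neg h]

/-- The deviations, taken with respect to the new ranks, undergo the same affine contraction at
every timer. This is what makes the desynchronization set attractive. -/
theorem deviation_resetTop (hε : -1 < ε) {σ : Equiv.Perm (Fin N)}
    {τ : EuclideanSpace ℝ (Fin N)} (h : IsRanking σ τ) (hD : τ ∈ jumpSet N τbar) (i : Fin N) :
    deviation τbar ε (promote σ) (resetTop ε σ τ) i =
      (1 + ε) * deviation τbar ε σ τ i - bottomLevel N τbar ε := by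
  by_cases hi : (σ i : ℕ) = 0
  · rw [deviation, deviation, resetTop_apply_of_eq_zero τ hi,
      sortedPoint_of_val_eq_last (promote_val_of_eq_zero hi), sortedPoint_of_val_eq_zero hε hi,
      h.eq_of_val_eq_zero hD hi]
    ring
  · have := promote_val_of_ne_zero hi
    rw [deviation, deviation, resetTop_apply_of_ne_zero τ hi,
      sortedPoint_of_val_succ (k := promote σ i) (l := σ i) (by omega)]
    ring

theorem SpreadLE.promote_resetTop (hε : -1 < ε) {σ : Equiv.Perm (Fin N)}
    {τ : EuclideanSpace ℝ (Fin N)} {δ : ℝ} (h : SpreadLE τbar ε σ τ δ) (hσ : IsRanking σ τ)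
    (hD : τ ∈ jumpSet N τbar) :
    SpreadLE τbar ε (promote σ) (resetTop ε σ τ) ((1 + ε) * δ) := fun i r => by
  rw [deviation_resetTop hε hσ hD, deviation_resetTop hε hσ hD]
  have := mul_le_mul_of_nonneg_left (h i r) (show 0 ≤ 1 + ε by linarith)
  linarith

theorem IsRanking.promote_resetTop (hε : -1 < ε) {σ : Equiv.Perm (Fin N)}
    {τ : EuclideanSpace ℝ (Fin N)} (h : IsRanking σ τ) (hτ : ∀ i, 0 ≤ τ i) :
    IsRanking (promote σ) (resetTop ε σ τ) := by
  have hq : 0 ≤ 1 + ε := by linarith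
  intro i r hir
  rw [Fin.le_def] at hir
  have hr := (σ r).2
  by_cases h0 : (σ r : ℕ) = 0
  · rw [resetTop_apply_of_eq_zero τ h0]
    by_cases h1 : (σ i : ℕ) = 0
    · rw [resetTop_apply_of_eq_zero τ h1]
    · rw [resetTop_apply_of_ne_zero τ h1]
      exact mul_nonneg hq (hτ i)
  · rw [promote_val_of_ne_zero h0] at hir
    by_cases h1 : (σ i : ℕ) = 0
    · rw [promote_val_of_eq_zero h1] at hir
      omega
    · rw [promote_val_of_ne_zero h1] at hir
      rw [resetTop_apply_of_ne_zero τ h0, resetTop_apply_of_ne_zero τ h1]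
      exact mul_le_mul_of_nonneg_left (h i r (Fin.le_def.2 (by omega))) hq

theorem IsStrictRanking.promote_resetTop (hε : -1 < ε) {σ : Equiv.Perm (Fin N)}
    {τ : EuclideanSpace ℝ (Fin N)} (h : IsStrictRanking σ τ) (hτ : ∀ i, 0 < τ i) :
    IsStrictRanking (promote σ) (resetTop ε σ τ) := by
  refine (h.isRanking.promote_resetTop hε fun i => (hτ i).le).isStrictRanking fun i r hir => ?_
  have hq : 0 < 1 + ε := by linarith
  have hne : ∀ i r, i ≠ r → τ i ≠ τ r := by
    intro i r hir
    rcases lt_or_gt_of_ne (σ.injective.ne hir) with h' | h'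
    exacts [(h i r h').ne', (h r i h').ne]
  by_cases h0 : (σ i : ℕ) = 0 <;> by_cases h1 : (σ r : ℕ) = 0
  · exact absurd (σ.injective (Fin.ext (h0.trans h1.symm))) hir
  · rw [resetTop_apply_of_eq_zero τ h0, resetTop_apply_of_ne_zero τ h1]
    exact (mul_pos hq (hτ r)).ne
  · rw [resetTop_apply_of_ne_zero τ h0, resetTop_apply_of_eq_zero τ h1]
    exact (mul_pos hq (hτ i)).ne'
  · rw [resetTop_apply_of_ne_zero τ h0, resetTop_apply_of_ne_zero τ h1]
    exact fun e => hne i r hir (mul_left_cancel₀ hq.ne' e)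

theorem resetTop_mem_jumpMap {σ : Equiv.Perm (Fin N)} {τ : EuclideanSpace ℝ (Fin N)}
    (h : IsRanking σ τ) (hD : τ ∈ jumpSet N τbar) :
    resetTop ε σ τ ∈ (system N τbar ω ε).jumpMap τ := by
  intro i
  by_cases hi : (σ i : ℕ) = 0
  · rw [resetTop_apply_of_eq_zero τ hi]
    have hτi := h.eq_of_val_eq_zero hD hi
    by_cases hr : ∃ r, r ≠ i ∧ τ r = τbar
    · exact Or.inr (Or.inl ⟨hτi, hr, Or.inl rfl⟩)
    · push Not at hr
      exact Or.inl ⟨hτi, fun r hri => lt_of_le_of_ne (hD.1 r).2 (hr r hri), rfl⟩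
  · rw [resetTop_apply_of_ne_zero τ hi]
    have hr : ∃ r, r ≠ i ∧ τ r = τbar := by
      have ht : (σ (σ.symm ⟨0, i.pos⟩) : ℕ) = 0 := by simp
      exact ⟨_, fun e => hi (e ▸ ht), h.eq_of_val_eq_zero hD ht⟩
    rcases (hD.1 i).2.eq_or_lt with hi' | hi'
    · exact Or.inr (Or.inl ⟨hi', hr, Or.inr rfl⟩)
    · exact Or.inr (Or.inr ⟨hi', hr, rfl⟩)

/-- Without ties, the jump is forced. -/
theorem IsStrictRanking.eq_resetTop {σ : Equiv.Perm (Fin N)} {τ y : EuclideanSpace ℝ (Fin N)}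
    (h : IsStrictRanking σ τ) (hD : τ ∈ jumpSet N τbar)
    (hy : y ∈ (system N τbar ω ε).jumpMap τ) : y = resetTop ε σ τ := by
  have hlt : ∀ {i r : Fin N}, τ i = τbar → r ≠ i → τ r < τbar := by
    intro i r hi hri
    refine lt_of_le_of_ne (hD.1 r).2 fun hr => ?_
    rcases lt_or_gt_of_ne (σ.injective.ne hri) with h' | h'
    · exact (h r i h').ne (hi.trans hr.symm)
    · exact (h i r h').ne (hr.trans hi.symm)
  ext i
  by_cases hi : (σ i : ℕ) = 0
  · rw [resetTop_apply_of_eq_zero τ hi]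
    have hτi := h.isRanking.eq_of_val_eq_zero hD hi
    rcases hy i with ⟨-, -, e⟩ | ⟨-, ⟨r, hr, hr'⟩, -⟩ | ⟨h1, -, -⟩
    · exact e
    · exact absurd hr' (hlt hτi hr).ne
    · exact absurd hτi h1.ne
  · rw [resetTop_apply_of_ne_zero τ hi]
    have ht : (σ (σ.symm ⟨0, i.pos⟩) : ℕ) = 0 := by simp
    have hτi := hlt (h.isRanking.eq_of_val_eq_zero hD ht) (r := i) fun e => hi (by rw [e]; exact ht)
    rcases hy i with ⟨h1, -, -⟩ | ⟨h1, -, -⟩ | ⟨-, -, e⟩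
    · exact absurd h1 hτi.ne
    · exact absurd h1 hτi.ne
    · exact e

/-! ### Convergence along a ranking -/

/-- Starting with the ranking `σ`, every jump of the sequence `ξ` resets the timer of rank zero
only. -/
def FollowsRanking (τbar ω ε : ℝ) (σ : Equiv.Perm (Fin N)) (ξ : ℕ → EuclideanSpace ℝ (Fin N)) :
    Prop :=
  ∀ j, IsRanking (promote^[j] σ) (ξ j) ∧
    ξ (j + 1) = resetTop ε (promote^[j] σ) (hit τbar ω (ξ j))

theorem FollowsRanking.spreadLE (hN : 0 < N) (hω : 0 < ω) (hε : -1 < ε) (hε' : ε < 0)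
    {ξ : ℕ → EuclideanSpace ℝ (Fin N)} (hξ : IsJumpSeq τbar ω ε ξ) {σ : Equiv.Perm (Fin N)}
    (h : FollowsRanking τbar ω ε σ ξ) {δ : ℝ} (hδ : SpreadLE τbar ε σ (ξ 0) δ) (j : ℕ) :
    SpreadLE τbar ε (promote^[j] σ) (ξ j) ((1 + ε) ^ j * δ) := by
  induction j with
  | zero => simpa using hδ
  | succ j ih =>
    rw [Function.iterate_succ_apply', (h j).2, pow_succ', mul_assoc]
    exact (ih.flow _).promote_resetTop hε ((h j).1.flow _)
      (hit_mem_jumpSet hN hω (hξ.mem_cube hN hω hε hε' j))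

theorem FollowsRanking.infDist_arc_le (hN : 0 < N) (hτ : 0 < τbar) (hω : 0 < ω) (hε : -1 < ε)
    (hε' : ε < 0) {ξ : ℕ → EuclideanSpace ℝ (Fin N)} (hξ : IsJumpSeq τbar ω ε ξ)
    {σ : Equiv.Perm (Fin N)} (h : FollowsRanking τbar ω ε σ ξ) {δ : ℝ}
    (hδ : SpreadLE τbar ε σ (ξ 0) δ) {t : ℝ} {j : ℕ} (ht : (t, j) ∈ (arc τbar ω ξ).dom) :
    Metric.infDist ((arc τbar ω ξ).toFun t j) (desyncSet N τbar ε) ≤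
      N * ((1 + ε) ^ j * δ) :=
  infDist_desyncSet_le hN hτ hε (hξ.arc_mem_cube hN hω hε hε' ht)
    ((h.spreadLE hN hω hε hε' hξ hδ j).flow _)

/-- Since the time between two jumps is bounded, hybrid time can only go to infinity if the number
of jumps does. -/
theorem IsJumpSeq.tendsto_snd (hN : 0 < N) (hω : 0 < ω) (hε : -1 < ε) (hε' : ε < 0)
    {ξ : ℕ → EuclideanSpace ℝ (Fin N)} (hξ : IsJumpSeq τbar ω ε ξ)
    {S : Set (ℝ × ℕ)} (hS : S ⊆ (arc τbar ω ξ).dom) :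
    Tendsto (fun p : ℝ × ℕ => p.2)
      (comap (fun p : ℝ × ℕ => p.1 + (p.2 : ℝ)) atTop ⊓ 𝓟 S) atTop := by
  refine tendsto_atTop.2 fun n => ?_
  have h1 : ∀ᶠ p : ℝ × ℕ in comap (fun p : ℝ × ℕ => p.1 + (p.2 : ℝ)) atTop ⊓ 𝓟 S,
      n * (τbar / ω) + n ≤ p.1 + (p.2 : ℝ) :=
    (tendsto_comap.eventually (eventually_ge_atTop _)).filter_mono inf_le_left
  have h2 : ∀ᶠ p : ℝ × ℕ in comap (fun p : ℝ × ℕ => p.1 + (p.2 : ℝ)) atTop ⊓ 𝓟 S, p ∈ S :=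
    (eventually_principal.2 fun _ h => h).filter_mono inf_le_right
  filter_upwards [h1, h2] with p hp hpS
  by_contra! hlt
  have h3 := (hS hpS).2.trans ((hξ.monotone_jumpTime hN hω hε hε' hlt).trans
    (hξ.jumpTime_le hN hω hε hε' n))
  have h4 : (p.2 : ℝ) < n := by exact_mod_cast hlt
  linarith

theorem FollowsRanking.convergesTo (hN : 0 < N) (hτ : 0 < τbar) (hω : 0 < ω) (hε : -1 < ε)
    (hε' : ε < 0) {ξ : ℕ → EuclideanSpace ℝ (Fin N)} (hξ : IsJumpSeq τbar ω ε ξ)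
    {σ : Equiv.Perm (Fin N)} (h : FollowsRanking τbar ω ε σ ξ)
    {x : HybridFun (EuclideanSpace ℝ (Fin N))} (hsub : x.dom ⊆ (arc τbar ω ξ).dom)
    (heq : ∀ t j, (t, j) ∈ x.dom → x.toFun t j = (arc τbar ω ξ).toFun t j) :
    x.ConvergesTo (desyncSet N τbar ε) := by
  obtain ⟨δ, hδ⟩ := exists_spreadLE (τbar := τbar) (ε := ε) σ (ξ 0)
  have hlim : Tendsto (fun j : ℕ => N * ((1 + ε) ^ j * δ)) atTop (𝓝 0) := by
    simpa using ((tendsto_pow_atTop_nhds_zero_of_lt_one (by linarith)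
      (by linarith : 1 + ε < 1)).mul_const δ).const_mul (N : ℝ)
  refine squeeze_zero' (Eventually.of_forall fun p => Metric.infDist_nonneg) ?_
    (hlim.comp (hξ.tendsto_snd hN hω hε hε' hsub))
  refine (eventually_principal.2 fun p hp => ?_).filter_mono inf_le_right
  rw [heq p.1 p.2 hp]
  exact h.infDist_arc_le hN hτ hω hε hε' hξ hδ (hsub hp)

theorem exists_followsRanking (hN : 0 < N) (hω : 0 < ω) (hε : -1 < ε) (hε' : ε < 0)
    {τ : EuclideanSpace ℝ (Fin N)} (hτ : τ ∈ cube N τbar) {σ : Equiv.Perm (Fin N)}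
    (hσ : IsRanking σ τ) :
    ∃ ξ : ℕ → EuclideanSpace ℝ (Fin N), ξ 0 = τ ∧ IsJumpSeq τbar ω ε ξ ∧
      FollowsRanking τbar ω ε σ ξ := by
  let ξ : ℕ → EuclideanSpace ℝ (Fin N) := fun j =>
    Nat.rec τ (fun j η => resetTop ε (promote^[j] σ) (hit τbar ω η)) j
  have hstep : ∀ j, ξ (j + 1) = resetTop ε (promote^[j] σ) (hit τbar ω (ξ j)) := fun j => rfl
  have key : ∀ j, ξ j ∈ cube N τbar ∧ IsRanking (promote^[j] σ) (ξ j) := by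
    intro j
    induction j with
    | zero => exact ⟨hτ, hσ⟩
    | succ j ih =>
      have hD := hit_mem_jumpSet hN hω ih.1
      have hR : IsRanking (promote^[j] σ) (hit τbar ω (ξ j)) := ih.2.flow _
      rw [hstep, Function.iterate_succ_apply']
      exact ⟨jumpMap_subset_cube hε hε' hD (resetTop_mem_jumpMap (ω := ω) hR hD),
        hR.promote_resetTop hε fun i => (hD.1 i).1⟩
  exact ⟨ξ, rfl, ⟨hτ, fun j => hstep j ▸ resetTop_mem_jumpMap ((key j).2.flow _)
    (hit_mem_jumpSet hN hω (key j).1)⟩, fun j => ⟨(key j).2, hstep j⟩⟩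

/-! ### Initial states with forced jumps -/

/-- From a state without ties, and without a timer at zero if some timer is at the threshold, all
jumps reset the timer of rank zero only. -/
theorem IsJumpSeq.followsRanking (hN : 0 < N) (hτ : 0 < τbar) (hω : 0 < ω) (hε : -1 < ε)
    (hε' : ε < 0) {ξ : ℕ → EuclideanSpace ℝ (Fin N)} (hξ : IsJumpSeq τbar ω ε ξ)
    {σ : Equiv.Perm (Fin N)} (hσ : IsStrictRanking σ (ξ 0))
    (h0 : ∀ r, ξ 0 r = τbar → ∀ i, 0 < ξ 0 i) : FollowsRanking τbar ω ε σ ξ := by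
  have hcube := hξ.mem_cube hN hω hε hε'
  have hD := fun j => hit_mem_jumpSet hN hω (hcube j)
  have hforced : ∀ j, IsStrictRanking (promote^[j] σ) (ξ j) →
      ξ (j + 1) = resetTop ε (promote^[j] σ) (hit τbar ω (ξ j)) := fun j h =>
    (h.flow _).eq_resetTop (hD j) (hξ.2 j)
  have key : ∀ j, IsStrictRanking (promote^[j] σ) (ξ j) ∧ ∀ r, ξ j r = τbar → ∀ i, 0 < ξ j i := by
    intro j
    induction j with
    | zero => exact ⟨hσ, h0⟩
    | succ j ih =>
      have hpos : ∀ i, 0 < hit τbar ω (ξ j) i := by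
        intro i
        rcases (hitTime_nonneg hN hω (hcube j)).eq_or_lt with h | h
        · obtain ⟨r, hr⟩ := (hD j).2
          have he : ∀ i, hit τbar ω (ξ j) i = ξ j i := fun i => by
            rw [hit, flow_apply, ← h, zero_mul, add_zero]
          rw [he] at hr ⊢
          exact ih.2 r hr i
        · rw [hit, flow_apply]
          have := (hcube j i).1
          positivity
      have hstep := hforced j ih.1
      refine ⟨?_, fun r hr => ?_⟩
      · rw [hstep, Function.iterate_succ_apply']
        exact (ih.1.flow _).promote_resetTop hε hpos
      · -- right after a jump no timer is at the threshold
        exfalso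
        rw [hstep] at hr
        by_cases hr0 : (promote^[j] σ r : ℕ) = 0
        · rw [resetTop_apply_of_eq_zero _ hr0] at hr
          exact hτ.ne hr
        · rw [resetTop_apply_of_ne_zero _ hr0] at hr
          have h1 := ((hD j).1 r).2
          have h2 := hpos r
          nlinarith
  exact fun j => ⟨(key j).1.isRanking, hforced j (key j).1⟩

theorem injective_and_pos_of_notMem_exceptionalSet (hτ : 0 < τbar)
    {τ : EuclideanSpace ℝ (Fin N)} (h : τ ∈ cube N τbar \ exceptionalSet N τbar) :
    (∀ i r, i ≠ r → τ i ≠ τ r) ∧ ∀ r, τ r = τbar → ∀ i, 0 < τ i := by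
  obtain ⟨hc, hX⟩ := h
  have h1 : τ ∉ coincident N τbar := fun h => hX (Or.inl h)
  refine ⟨fun i r hir he => h1 ⟨hc, i, r, hir, he⟩, fun r hr i => ?_⟩
  refine lt_of_le_of_ne (hc i).1 fun hi => hX (Or.inr ⟨⟨⟨hc, r, hr⟩, h1⟩, i, r, ?_, hi.symm, hr⟩)
  rintro rfl
  exact hτ.ne (hi.trans hr)

/-- Near the desynchronization set there are no ties and no exceptional states. -/
theorem isStrictRanking_of_spreadLE (hτ : 0 < τbar) (hε : -1 < ε) {γ δ : ℝ} (hδγ : δ < γ)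
    (hγ : ∀ k l : Fin N, k < l → γ ≤ sortedPoint N τbar ε k - sortedPoint N τbar ε l)
    (hγ' : ∀ k : Fin N, γ ≤ sortedPoint N τbar ε k) {σ : Equiv.Perm (Fin N)}
    {τ : EuclideanSpace ℝ (Fin N)} (h : SpreadLE τbar ε σ τ δ) :
    IsStrictRanking σ τ ∧ ∀ r, τ r = τbar → ∀ i, 0 < τ i := by
  refine ⟨fun i r hir => ?_, fun r hr i => ?_⟩
  · have h1 := h r i
    have h2 := hγ _ _ hir
    simp only [deviation] at h1
    linarith
  · have h1 := h r i
    have h2 := hγ' (σ i)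
    have h3 := sortedPoint_le hτ hε (σ r)
    simp only [deviation] at h1
    linarith

/-! ### Persistent ties -/

/-- The jump successor in which all timers at the threshold are reset. -/
def resetAll (τbar ε : ℝ) (τ : EuclideanSpace ℝ (Fin N)) : EuclideanSpace ℝ (Fin N) :=
  WithLp.toLp 2 fun i => if τ i = τbar then 0 else (1 + ε) * τ i

theorem resetAll_apply (τ : EuclideanSpace ℝ (Fin N)) (i : Fin N) :
    resetAll τbar ε τ i = if τ i = τbar then 0 else (1 + ε) * τ i := rfl

theorem resetAll_mem_jumpMap {τ : EuclideanSpace ℝ (Fin N)} (hD : τ ∈ jumpSet N τbar) :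
    resetAll τbar ε τ ∈ (system N τbar ω ε).jumpMap τ := by
  intro i
  rw [resetAll_apply]
  split_ifs with hi
  · by_cases hr : ∃ r, r ≠ i ∧ τ r = τbar
    · exact Or.inr (Or.inl ⟨hi, hr, Or.inl rfl⟩)
    · push Not at hr
      exact Or.inl ⟨hi, fun r hri => lt_of_le_of_ne (hD.1 r).2 (hr r hri), rfl⟩
  · obtain ⟨k, hk⟩ := hD.2
    exact Or.inr (Or.inr ⟨lt_of_le_of_ne (hD.1 i).2 hi, ⟨k, fun e => hi (e ▸ hk), hk⟩, rfl⟩)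

/-- From an exceptional state, resetting all timers at the threshold at every jump keeps two timers
equal forever after the first jump. -/
theorem exists_isJumpSeq_tie (hN : 0 < N) (hω : 0 < ω) (hε : -1 < ε) (hε' : ε < 0)
    {τ : EuclideanSpace ℝ (Fin N)} (hX : τ ∈ exceptionalSet N τbar) :
    ∃ ξ : ℕ → EuclideanSpace ℝ (Fin N), ξ 0 = τ ∧ IsJumpSeq τbar ω ε ξ ∧
      ∃ i r, i ≠ r ∧ ∀ j, ξ (j + 1) i = ξ (j + 1) r := by
  have hc : τ ∈ cube N τbar := by
    rcases hX with h | h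
    exacts [h.1, h.1.1.1]
  let ξ : ℕ → EuclideanSpace ℝ (Fin N) := fun j =>
    Nat.rec τ (fun _ η => resetAll τbar ε (hit τbar ω η)) j
  have hstep : ∀ j, ξ (j + 1) = resetAll τbar ε (hit τbar ω (ξ j)) := fun j => rfl
  have hcube : ∀ j, ξ j ∈ cube N τbar := by
    intro j
    induction j with
    | zero => exact hc
    | succ j ih =>
      have hD := hit_mem_jumpSet hN hω ih
      exact jumpMap_subset_cube hε hε' hD (resetAll_mem_jumpMap (ω := ω) hD)
  have htie : ∀ j i r, ξ j i = ξ j r → ξ (j + 1) i = ξ (j + 1) r := by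
    intro j i r h
    rw [hstep, resetAll_apply, resetAll_apply, hit, flow_apply, flow_apply, h]
  have htie' : ∀ i r, ξ 1 i = ξ 1 r → ∀ j, ξ (j + 1) i = ξ (j + 1) r := by
    intro i r h j
    induction j with
    | zero => exact h
    | succ j ih => exact htie (j + 1) i r ih
  refine ⟨ξ, rfl, ⟨hc, fun j => hstep j ▸ resetAll_mem_jumpMap (hit_mem_jumpSet hN hω (hcube j))⟩,
    ?_⟩
  rcases hX with ⟨-, i, r, hir, h⟩ | ⟨-, i, r, hir, hi, hr⟩
  · exact ⟨i, r, hir, htie' i r (htie 0 i r h)⟩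
  · refine ⟨i, r, hir, htie' i r ?_⟩
    have hT : hitTime τbar ω τ = 0 := le_antisymm
      (hitTime_le_of_flow_eq hN hω (i := r) (by simpa using hr)) (hitTime_nonneg hN hω hc)
    have hhit : ∀ k, hit τbar ω τ k = τ k := fun k => by simp [hit, hT]
    have h1 : ξ 1 = resetAll τbar ε (hit τbar ω τ) := rfl
    rw [h1, resetAll_apply, resetAll_apply, hhit, hhit, hi, hr]
    simp

theorem not_convergesTo_of_tie (hN : 0 < N) (hτ : 0 < τbar) (hω : 0 < ω) (hε : -1 < ε)
    (hε' : ε < 0) {ξ : ℕ → EuclideanSpace ℝ (Fin N)} (hξ : IsJumpSeq τbar ω ε ξ) {i r : Fin N}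
    (hir : i ≠ r) (h : ∀ j, ξ (j + 1) i = ξ (j + 1) r) :
    ¬ (arc τbar ω ξ).ConvergesTo (desyncSet N τbar ε) := by
  intro hconv
  obtain ⟨γ, hγ0, hγ, -⟩ := exists_pos_le_sortedPoint_sub (ε := ε) hN hτ hε hε'
  have hev := hconv.eventually (gt_mem_nhds (show (0 : ℝ) < γ / 2 by positivity))
  rw [eventually_inf_principal, eventually_comap, eventually_atTop] at hev
  obtain ⟨M, hM⟩ := hev
  obtain ⟨n, hn⟩ := exists_nat_gt M
  have hdom := hξ.jumpTime_mem_arc_dom hN hω hε hε' (n + 1)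
  have ht0 : 0 ≤ jumpTime τbar ω ξ (n + 1) := by
    simpa using hξ.monotone_jumpTime hN hω hε hε' (Nat.zero_le (n + 1))
  have hlt := hM _ (by push_cast; linarith) (jumpTime τbar ω ξ (n + 1), n + 1) rfl hdom
  have hval : (arc τbar ω ξ).toFun (jumpTime τbar ω ξ (n + 1)) (n + 1) = ξ (n + 1) := by
    simp [arc, flow]
  rw [hval] at hlt
  obtain ⟨σ, hσ⟩ := exists_spreadLE_of_infDist_le hN hτ hε le_rfl (τ := ξ (n + 1))
  have h1 := hσ i r
  have h2 := hσ r i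
  simp only [deviation, h n] at h1 h2
  rcases lt_or_gt_of_ne (σ.injective.ne hir) with h' | h'
  · linarith [hγ _ _ h']
  · linarith [hγ _ _ h']

/-! ### Stability and the basin of attraction -/

theorem system_isStable (hN : 0 < N) (hτ : 0 < τbar) (hω : 0 < ω) (hε : -1 < ε) (hε' : ε < 0) :
    (system N τbar ω ε).IsStable (desyncSet N τbar ε) := by
  intro r hr
  obtain ⟨γ, hγ0, hγ, hγ'⟩ := exists_pos_le_sortedPoint_sub (ε := ε) hN hτ hε hε'
  have hN' : (0 : ℝ) < N := by exact_mod_cast hN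
  refine ⟨min (γ / 4) (r / (2 * N)), by positivity, fun x hx hx0 t j htj => ?_⟩
  obtain ⟨ξ, hξ, h0, hsub, heq⟩ := exists_isJumpSeq_of_isSolution hN hω hε hε' hx
  obtain ⟨σ, hσ⟩ := exists_spreadLE_of_infDist_le hN hτ hε hx0
  rw [← h0] at hσ
  have hsmall := min_le_left (γ / 4) (r / (2 * N))
  obtain ⟨hs, hpos⟩ := isStrictRanking_of_spreadLE hτ hε (by linarith) hγ hγ' hσ
  have hf := hξ.followsRanking hN hτ hω hε hε' hs hpos
  rw [heq t j htj]
  refine (hf.infDist_arc_le hN hτ hω hε hε' hξ hσ (hsub htj)).trans ?_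
  have h1 : (1 + ε) ^ j ≤ 1 := pow_le_one₀ (by linarith) (by linarith)
  have h2 : 0 ≤ 2 * min (γ / 4) (r / (2 * N)) := by positivity
  calc (N : ℝ) * ((1 + ε) ^ j * (2 * min (γ / 4) (r / (2 * N))))
      ≤ N * (2 * (r / (2 * N))) := by
        refine mul_le_mul_of_nonneg_left ?_ hN'.le
        exact (mul_le_of_le_one_left h2 h1).trans (by linarith [min_le_right (γ / 4) (r / (2 * N))])
    _ = r := by field_simp

/-- Maximal solutions from states with forced jumps are complete and converge. -/
theorem isComplete_and_convergesTo (hN : 0 < N) (hτ : 0 < τbar) (hω : 0 < ω) (hε : -1 < ε)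
    (hε' : ε < 0) {x : HybridFun (EuclideanSpace ℝ (Fin N))}
    (hx : x.IsMaximalSolution (system N τbar ω ε)) {σ : Equiv.Perm (Fin N)}
    (hσ : IsStrictRanking σ (x.toFun 0 0))
    (h0 : ∀ r, x.toFun 0 0 r = τbar → ∀ i, 0 < x.toFun 0 0 i) :
    x.IsComplete ∧ x.ConvergesTo (desyncSet N τbar ε) := by
  obtain ⟨ξ, hξ, hξ0, hsub, heq⟩ := exists_isJumpSeq_of_isSolution hN hω hε hε' hx.1
  rw [← hξ0] at hσ h0
  exact ⟨isComplete_of_isMaximalSolution hN hω hε hε' hx,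
    (hξ.followsRanking hN hτ hω hε hε' hσ h0).convergesTo hN hτ hω hε hε' hξ hsub heq⟩

theorem system_isAttractive (hN : 0 < N) (hτ : 0 < τbar) (hω : 0 < ω) (hε : -1 < ε)
    (hε' : ε < 0) : (system N τbar ω ε).IsAttractive (desyncSet N τbar ε) := by
  obtain ⟨γ, hγ0, hγ, hγ'⟩ := exists_pos_le_sortedPoint_sub (ε := ε) hN hτ hε hε'
  refine ⟨γ / 4, by positivity, fun x hx hx0 => ?_⟩
  obtain ⟨σ, hσ⟩ := exists_spreadLE_of_infDist_le hN hτ hε hx0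
  obtain ⟨hs, hpos⟩ := isStrictRanking_of_spreadLE hτ hε (by linarith) hγ hγ' hσ
  exact isComplete_and_convergesTo hN hτ hω hε hε' hx hs hpos

theorem flowSet_union_jumpSet : (system N τbar ω ε).flowSet ∪ (system N τbar ω ε).jumpSet =
    cube N τbar :=
  union_eq_left.2 fun _ h => h.1

theorem system_basinOfAttraction (hN : 0 < N) (hτ : 0 < τbar) (hω : 0 < ω) (hε : -1 < ε)
    (hε' : ε < 0) : (system N τbar ω ε).basinOfAttraction (desyncSet N τbar ε) =
      cube N τbar \ exceptionalSet N τbar := by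
  rw [HybridSystem.basinOfAttraction, flowSet_union_jumpSet]
  ext τ
  constructor
  · rintro ⟨hc, h⟩
    refine ⟨hc, fun hX => ?_⟩
    obtain ⟨ξ, hξ0, hξ, i, r, hir, htie⟩ := exists_isJumpSeq_tie hN hω hε hε' hX
    exact not_convergesTo_of_tie hN hτ hω hε hε' hξ hir htie
      (h _ (hξ.isMaximalSolution_arc hN hω hε hε') (by simp [arc, flow, hξ0])).2
  · intro h
    refine ⟨h.1, fun x hx hx0 => ?_⟩
    obtain ⟨hne, hpos⟩ := injective_and_pos_of_notMem_exceptionalSet hτ h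
    obtain ⟨σ, hσ⟩ := exists_isRanking τ
    exact isComplete_and_convergesTo hN hτ hω hε hε' hx (hx0 ▸ hσ.isStrictRanking hne)
      (hx0 ▸ hpos)

theorem system_isWeaklyGloballyAsymptoticallyStable (hN : 0 < N) (hτ : 0 < τbar) (hω : 0 < ω)
    (hε : -1 < ε) (hε' : ε < 0) :
    (system N τbar ω ε).IsWeaklyGloballyAsymptoticallyStable (desyncSet N τbar ε) := by
  refine ⟨system_isStable hN hτ hω hε hε', ?_⟩
  rw [flowSet_union_jumpSet]
  intro τ hc
  obtain ⟨σ, hσ⟩ := exists_isRanking τ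
  obtain ⟨ξ, hξ0, hξ, hf⟩ := exists_followsRanking (ω := ω) hN hω hε hε' hc hσ
  exact ⟨arc τbar ω ξ, hξ.isMaximalSolution_arc hN hω hε hε', by simp [arc, flow, hξ0],
    hξ.isComplete_arc hN hω hε hε',
    hf.convergesTo hN hτ hω hε hε' hξ subset_rfl fun _ _ _ => rfl⟩

end ImpulseOscillators

end

theorem mainTheorem1 (N : ℕ) (hN : 1 < N) (τbar ω ε : ℝ) (hτbar : 0 < τbar) (hω : 0 < ω)
    (hε : -1 < ε) (hε' : ε < 0) :
    IsCompact (ImpulseOscillators.desyncSet N τbar ε) ∧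
    (ImpulseOscillators.system N τbar ω ε).IsAsymptoticallyStable
      (ImpulseOscillators.desyncSet N τbar ε) ∧
    (ImpulseOscillators.system N τbar ω ε).basinOfAttraction
      (ImpulseOscillators.desyncSet N τbar ε) =
        ImpulseOscillators.cube N τbar \ ImpulseOscillators.exceptionalSet N τbar ∧
    (ImpulseOscillators.system N τbar ω ε).IsWeaklyGloballyAsymptoticallyStable
      (ImpulseOscillators.desyncSet N τbar ε) := by
  have hN' : 0 < N := by omega
  exact ⟨ImpulseOscillators.isCompact_desyncSet hN' hτbar hε,
    ⟨ImpulseOscillators.system_isStable hN' hτbar hω hε hε',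
      ImpulseOscillators.system_isAttractive hN' hτbar hω hε hε'⟩,
    ImpulseOscillators.system_basinOfAttraction hN' hτbar hω hε hε',
    ImpulseOscillators.system_isWeaklyGloballyAsymptoticallyStable hN' hτbar hω hε hε'⟩
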